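/- Identify the Heisenberg group $\mathbb H^1$ with $\mathbb R^3$, with the fields $X_1=\partial_x-\frac y2\partial_t$ and $X_2=\partial_y+\frac x2\partial_t$. Let $\Omega\subset\mathbb R^2$ be a domain, $u\in C^1(\Omega)$, and let $S=\{(x,y,t) : (x,y)\in\Omega,\ t=u(x,y)\}$. Put $p=X_1(t-u(x,y))$ and $q=X_2(t-u(x,y))$. Assume that $S$ has no characteristic points, i.e. $p$ and $q$ do not both vanish at any point of $\Omega$. Regard the unit horizontal Gauss map $\nu_X=(\bar p,\bar q)=(p,q)/\sqrt{p^2+q^2}$ as a vector field on $\Omega$, and write $(a,b)^\perp=(b,-a)$. Assume that $\bar p,\bar q\in W^{1,1}(\Omega)$ and that $S$ is H-minimal, i.e. that $$\int_\Omega \bar p\,\phi_x+\bar q\,\phi_y\,dx\,dy=0\qquad\text{for all }\phi\in C_0^\infty(\Omega).$$ By an integral curve of a vector field on $\Omega$ we mean one in $\Omega$ that is defined on an open interval. Then: 1. Every integral curve of $\nu_X^\perp$ is a straight line: $c(t)=c(t_0)+(t-t_0)\,\nu_X^\perp(c(t_0))$ for all $t_0,t$ in its interval. 2. Through every point of $\Omega$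 there passes an integral curve of $\nu_X$. Let $\gamma=(\gamma_1,\gamma_2):I\to\Omega$ be any integral curve of $\nu_X$, and put $h_0(s)=u(\gamma(s))$. For every $s_0\in I$ there is a $\delta>0$ with $(s_0-\delta,s_0+\delta)\subset I$ such that $$(s,r)\mapsto\Bigl(\gamma_1(s)+r\gamma_2'(s),\ \gamma_2(s)-r\gamma_1'(s),\ h_0(s)-\tfrac r2\langle\gamma(s),\gamma'(s)\rangle\Bigr)$$ is a homeomorphism of $(s_0-\delta,s_0+\delta)\times(-\delta,\delta)$ onto a relatively open subset of $S$ (which contains the point of $S$ above $\gamma(s_0)$). 3. For such a curve $\gamma$ let $F(s,r)=(\gamma_1(s)+r\gamma_2'(s),\gamma_2(s)-r\gamma_1'(s))$, let $d(s)\in[0,\infty]$ be the minimum of $\sup\{r_1>0 : F(s,r)\in\Omega\text{ for all }r\in(0,r_1)\}$ and $\sup\{r_2>0 : F(s,r)\in\Omega\text{ for all }r\in(-r_2,0)\}$, and let $d(\Omega,\gamma)=\inf\{d(s) : s\in I,\ \gamma(s)\in\Omega\}$ be the horizontal thickness. If $d(\Omega,\gamma)>\epsilon$ for some $\epsilon>0$,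 then $\gamma\in C^2(I)$ and $h_0\in C^1(I)$. -/

import Mathlib

open Set MeasureTheory
open scoped ENNReal ContDiff

noncomputable section

namespace HeisenbergGraph

/-- The `xy`-plane with its Euclidean structure. -/
abbrev Plane : Type := EuclideanSpace ℝ (Fin 2)

/-- The Heisenberg group in exponential coordinates: `((x, y), t)`. -/
abbrev Heis : Type := Plane × ℝ

/-- The value at `P = (x, y, t)` of the left invariant field `X₁ = ∂ₓ - (y/2) ∂ₜ`. -/
def fieldX1 (P : Heis) : Heis := (!₂[1, 0], -(P.1 1) / 2)

/-- The value at `P = (x, y, t)` of the left invariant field `X₂ = ∂_y + (x/2) ∂ₜ`. -/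
def fieldX2 (P : Heis) : Heis := (!₂[0, 1], (P.1 0) / 2)

/-- The derivative `X₁ f`. -/
def X1 (f : Heis → ℝ) (P : Heis) : ℝ := fderiv ℝ f P (fieldX1 P)

/-- The derivative `X₂ f`. -/
def X2 (f : Heis → ℝ) (P : Heis) : ℝ := fderiv ℝ f P (fieldX2 P)

/-- The graph `t = u(x, y)` over `Ω`. -/
def graphOver (u : Plane → ℝ) (Ω : Set Plane) : Set Heis := {P | P.1 ∈ Ω ∧ P.2 = u P.1}

/-- First component `p = X₁ (t - u(x, y))` of the horizontal Gauss map, at the point of the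
graph above `z`. -/
def gaussP (u : Plane → ℝ) (z : Plane) : ℝ := X1 (fun P => P.2 - u P.1) (z, u z)

/-- Second component `q = X₂ (t - u(x, y))` of the horizontal Gauss map, at the point of the
graph above `z`. -/
def gaussQ (u : Plane → ℝ) (z : Plane) : ℝ := X2 (fun P => P.2 - u P.1) (z, u z)

/-- The point of the graph above `z` is characteristic. -/
def IsCharacteristic (u : Plane → ℝ) (z : Plane) : Prop := gaussP u z = 0 ∧ gaussQ u z = 0

/-- The unit horizontal Gauss map `ν_X = (p, q) / √(p² + q²)`, as a vector field on the plane. -/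
def nuX (u : Plane → ℝ) (z : Plane) : Plane :=
  !₂[gaussP u z / Real.sqrt (gaussP u z ^ 2 + gaussQ u z ^ 2),
    gaussQ u z / Real.sqrt (gaussP u z ^ 2 + gaussQ u z ^ 2)]

/-- The convention `(a, b)^⊥ = (b, -a)`. -/
def perp (v : Plane) : Plane := !₂[v 1, -(v 0)]

/-- Test functions: `φ ∈ C₀^∞(Ω)`. -/
structure IsTest (Ω : Set Plane) (φ : Plane → ℝ) : Prop where
  smooth : ContDiff ℝ ∞ φ
  compact : HasCompactSupport φ
  supp : tsupport φ ⊆ Ω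

/-- The `i`-th partial derivative of a function on the plane. -/
def partialDeriv (i : Fin 2) (φ : Plane → ℝ) (z : Plane) : ℝ :=
  fderiv ℝ φ z (EuclideanSpace.single i 1)

/-- `g` is the weak `i`-th partial derivative of `f` on `Ω`. -/
def IsWeakPartial (Ω : Set Plane) (i : Fin 2) (f g : Plane → ℝ) : Prop :=
  ∀ φ : Plane → ℝ, IsTest Ω φ →
    ∫ z in Ω, f z * partialDeriv i φ z = -∫ z in Ω, g z * φ z

/-- `f ∈ W^{1,1}(Ω)`. -/
def MemW11 (Ω : Set Plane) (f : Plane → ℝ) : Prop :=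
  IntegrableOn f Ω ∧ ∀ i : Fin 2, ∃ g : Plane → ℝ, IntegrableOn g Ω ∧ IsWeakPartial Ω i f g

/-- The graph of `u` over `Ω` is H-minimal: `div₀ ν_X = 0` weakly on `Ω`. -/
def IsHMinimal (u : Plane → ℝ) (Ω : Set Plane) : Prop :=
  ∀ φ : Plane → ℝ, IsTest Ω φ →
    ∫ z in Ω, (nuX u z 0 * partialDeriv 0 φ z + nuX u z 1 * partialDeriv 1 φ z) = 0

/-- `c` is an integral curve in `Ω`, with parameter in the open interval `I`, of the vector
field `V`. -/
structure IsCurveIn (Ω : Set Plane) (V : Plane → Plane) (I : Set ℝ) (c : ℝ → Plane) :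
    Prop where
  isOpen : IsOpen I
  ordConnected : I.OrdConnected
  mapsTo : MapsTo c I Ω
  integral : IsIntegralCurveOn c (fun _ => V) I

/-- A seed curve: an integral curve of `ν_X`. -/
def IsSeedCurve (u : Plane → ℝ) (Ω : Set Plane) (I : Set ℝ) (γ : ℝ → Plane) : Prop :=
  IsCurveIn Ω (nuX u) I γ

/-- `F(s, r) = (γ₁(s) + r γ₂'(s), γ₂(s) - r γ₁'(s))`. -/
def seedMap (γ : ℝ → Plane) (x : ℝ × ℝ) : Plane :=
  !₂[γ x.1 0 + x.2 * deriv γ x.1 1, γ x.1 1 - x.2 * deriv γ x.1 0]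

/-- The ruled surface `(F(s, r), h₀(s) - (r/2) ⟨γ(s), γ'(s)⟩)`. -/
def ruledMap (γ : ℝ → Plane) (h₀ : ℝ → ℝ) (x : ℝ × ℝ) : Heis :=
  (seedMap γ x, h₀ x.1 - x.2 / 2 * inner ℝ (γ x.1) (deriv γ x.1))

/-- `Φ` restricted to the open set `D` of parameters is a parameterization, i.e. a homeomorphism
onto its image, of a relatively open part of `S`. -/
structure IsLocalParam (S : Set Heis) (Φ : ℝ × ℝ → Heis) (D : Set (ℝ × ℝ)) : Prop where
  isOpen : IsOpen D
  embedding : Topology.IsEmbedding (D.domRestrict Φ)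
  image : ∃ V : Set Heis, IsOpen V ∧ Φ '' D = S ∩ V

/-- `d(s)`: the smaller of the lengths to which the rule through `γ(s)` stays in `Ω` on its two
sides, as an extended nonnegative real. -/
def thicknessAt (Ω : Set Plane) (γ : ℝ → Plane) (s : ℝ) : ℝ≥0∞ :=
  min (⨆ r ∈ {r : ℝ | 0 < r ∧ ∀ t ∈ Ioo 0 r, seedMap γ (s, t) ∈ Ω}, ENNReal.ofReal r)
    (⨆ r ∈ {r : ℝ | 0 < r ∧ ∀ t ∈ Ioo (-r) 0, seedMap γ (s, t) ∈ Ω}, ENNReal.ofReal r)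

/-- The horizontal thickness `d(Ω, γ)` of `Ω` along the curve `γ` with parameter in `I`. -/
def thickness (Ω : Set Plane) (I : Set ℝ) (γ : ℝ → Plane) : ℝ≥0∞ :=
  ⨅ s ∈ {s : ℝ | s ∈ I ∧ γ s ∈ Ω}, thicknessAt Ω γ s

end HeisenbergGraph

end

open HeisenbergGraph

/-! Absence of characteristic points makes `nuX u` a continuous unit field, and H-minimality says
that its weak divergence vanishes. Turned by a right angle it is weakly curl free, so near each
point it is the gradient of a differentiable `ψ` with `‖∇ψ‖ = 1` (`exists_potential`). Everything
about the rulings follows from this eikonal equation: `ψ` is 1-Lipschitz and grows at exactly unit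
rate along some segment from each point, so the gradient is constant on the line it spans
(`eq_along_line`). Comparing `ψ` with distances from points of these lines makes the gradient
locally Lipschitz (`norm_sub_le`).

Hence integral curves of the perpendicular field are straight, and seed curves exist by
Picard–Lindelöf. On a ruling `u` is affine, since its slope depends only on `⟨z, ν⟩`, which is
constant there. The map `(s, r) ↦ F(s, r)` is strictly differentiable at `(s₀, 0)` with an
orthonormal frame as derivative, so the inverse function theorem gives the parameterization.

For the regularity of the seed curve, fix a small `r ≠ 0` and compare the heights at the two ends of
the rulings of length `r`. Since `u` is differentiable at both ends and the tangent `m` is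
Lipschitz, a linear functional of `m` is differentiable. On the normal direction it equals `r` times
`gaussNorm - r/2`, taken at the far end, which is nonzero for small `r`. As `‖m‖ = 1` controls the
other component, `m` is differentiable, with a continuous formula for its derivative
(`hasDerivAt_tangent`). The height is then `C¹` as the composite of `u` with the seed curve. -/

open HeisenbergGraph

/-! ### Differentiable solutions of the eikonal equation -/

namespace Eikonal
open Metric Filter
open scoped Topology

variable {E : Type*} [NormedAddCommGroup E] [InnerProductSpace ℝ E]

/-- `ψ` is a differentiable solution of the eikonal equation on `B`, with gradient `N`. -/
structure IsSolution (ψ : E → ℝ) (N : E → E) (B : Set E) : Prop where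
  hasFDerivAt : ∀ x ∈ B, HasFDerivAt ψ (innerSL ℝ (N x)) x
  norm_eq_one : ∀ x ∈ B, ‖N x‖ = 1

namespace IsSolution

variable {ψ : E → ℝ} {N : E → E} {B : Set E}

theorem neg (h : IsSolution ψ N B) : IsSolution (fun x => -ψ x) (fun x => -N x) B where
  hasFDerivAt x hx := by
    have := (h.hasFDerivAt x hx).fun_neg
    rwa [← map_neg] at this
  norm_eq_one x hx := by rw [norm_neg, h.norm_eq_one x hx]

theorem hasDerivAt_comp (h : IsSolution ψ N B) {c : ℝ → E} {c' : E} {t : ℝ}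
    (hc : HasDerivAt c c' t) (hct : c t ∈ B) :
    HasDerivAt (fun s => ψ (c s)) (inner ℝ (N (c t)) c') t := by
  have := (h.hasFDerivAt _ hct).comp_hasDerivAt t hc
  rwa [innerSL_apply_apply] at this

theorem sub_le (h : IsSolution ψ N B) (hB : Convex ℝ B) {x y : E} (hx : x ∈ B) (hy : y ∈ B) :
    ψ y - ψ x ≤ ‖y - x‖ := by
  have := hB.norm_image_sub_le_of_norm_hasFDerivWithin_le (f := ψ) (C := 1)
    (fun z hz => (h.hasFDerivAt z hz).hasFDerivWithinAt)
    (fun z hz => by rw [innerSL_apply_norm, h.norm_eq_one z hz]) hx hy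
  rw [one_mul, Real.norm_eq_abs] at this
  exact (le_abs_self _).trans this

/-- A segment along which `ψ` grows at unit rate is a gradient line. -/
theorem eq_of_unit_growth (h : IsSolution ψ N B) (hB : Convex ℝ B) {x w : E} {r : ℝ}
    (hr : 0 < r) (hw : ‖w‖ = 1) (hx : x ∈ B) (hxr : x + r • w ∈ B)
    (hψ : ψ (x + r • w) = ψ x + r) {t : ℝ} (ht : t ∈ Icc 0 r) :
    ψ (x + t • w) = ψ x + t ∧ N (x + t • w) = w := by
  have hmem : ∀ s ∈ Icc 0 r, x + s • w ∈ B := by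
    intro s hs
    have := hB.add_smul_mem hx hxr (t := s / r)
      ⟨div_nonneg hs.1 hr.le, (div_le_one hr).2 hs.2⟩
    rwa [smul_smul, div_mul_cancel₀ _ hr.ne'] at this
  -- The 1-Lipschitz bounds on the two subsegments add up to the total growth, so neither can be
  -- strict.
  have hval : ∀ s ∈ Icc 0 r, ψ (x + s • w) = ψ x + s := by
    intro s hs
    have h1 := h.sub_le hB hx (hmem s hs)
    have h2 := h.sub_le hB (hmem s hs) hxr
    have e1 : x + s • w - x = s • w := by abel
    have e2 : x + r • w - (x + s • w) = (r - s) • w := by rw [sub_smul]; abel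
    rw [e1, norm_smul, hw, mul_one, Real.norm_of_nonneg hs.1] at h1
    rw [e2, norm_smul, hw, mul_one, Real.norm_of_nonneg (sub_nonneg.2 hs.2)] at h2
    linarith
  refine ⟨hval t ht, ?_⟩
  have hd : HasDerivAt (fun s : ℝ => x + s • w) w t := by
    simpa using ((hasDerivAt_id t).smul_const w).const_add x
  have h1 : HasDerivWithinAt (fun s : ℝ => ψ (x + s • w)) (inner ℝ (N (x + t • w)) w)
      (Icc 0 r) t :=
    (h.hasDerivAt_comp hd (hmem t ht)).hasDerivWithinAt
  have h2 : HasDerivWithinAt (fun s : ℝ => ψ (x + s • w)) 1 (Icc 0 r) t :=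
    (((hasDerivAt_id t).const_add (ψ x)).hasDerivWithinAt).congr hval (hval t ht)
  have h3 := (uniqueDiffOn_Icc hr t ht).eq_deriv _ h1 h2
  exact (inner_eq_one_iff_of_norm_eq_one (h.norm_eq_one _ (hmem t ht)) hw).1 h3

/-- A solution of the eikonal equation grows at unit rate in some direction. -/
theorem exists_unit_growth [ProperSpace E] (h : IsSolution ψ N B) (hB : Convex ℝ B) {x : E}
    {r : ℝ} (hr : 0 < r) (hxr : closedBall x r ⊆ B) :
    ∃ w : E, ‖w‖ = 1 ∧ ψ (x + r • w) = ψ x + r := by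
  have hxB : x ∈ B := hxr (mem_closedBall_self hr.le)
  have hN1 := h.norm_eq_one x hxB
  have hcont : ContinuousOn ψ (closedBall x r) :=
    fun y hy => (h.hasFDerivAt y (hxr hy)).continuousAt.continuousWithinAt
  obtain ⟨m, hm, hmax⟩ := (isCompact_sphere x r).exists_isMaxOn
    ⟨x + r • N x, by simp [hN1, norm_smul, abs_of_pos hr]⟩
    (hcont.mono sphere_subset_closedBall)
  have hmr : ‖m - x‖ = r := by rwa [mem_sphere_iff_norm] at hm
  -- every slope `k < 1` is attained on the sphere
  have key : ∀ k : ℝ, 0 ≤ k → k < 1 → ψ x + k * r ≤ ψ m := by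
    intro k hk0 hk
    -- Penalize by a cone of slope `k < 1`. The maximum cannot be interior: moving along `N z`
    -- raises `ψ` at rate 1 and the penalty at rate at most `k`.
    obtain ⟨z, hz, hzmax⟩ := (isCompact_closedBall x r).exists_isMaxOn
      ⟨x, mem_closedBall_self hr.le⟩
      (hcont.sub ((continuous_const.mul
        (continuous_norm.comp (continuous_id.sub continuous_const))).continuousOn) :
        ContinuousOn (fun y => ψ y - k * ‖y - x‖) (closedBall x r))
    have hzr : ‖z - x‖ ≤ r := by rwa [mem_closedBall_iff_norm] at hz
    rcases hzr.lt_or_eq with hlt | heq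
    · exfalso
      have hzB : z ∈ B := hxr hz
      have hloc : ∀ᶠ t : ℝ in 𝓝 0, ψ (z + t • N z) - k * ‖z + t • N z - x‖
          ≤ ψ z - k * ‖z - x‖ := by
        have hc : Tendsto (fun t : ℝ => z + t • N z) (𝓝 0) (𝓝 z) := by
          have : Continuous (fun t : ℝ => z + t • N z) := by fun_prop
          simpa using this.tendsto 0
        have hb : closedBall x r ∈ 𝓝 z :=
          Filter.mem_of_superset (isOpen_ball.mem_nhds (mem_ball_iff_norm.2 hlt))
            ball_subset_closedBall
        filter_upwards [hc hb] with t ht using hzmax ht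
      have hd : HasDerivAt (fun s : ℝ => z + s • N z) (N z) 0 := by
        simpa using ((hasDerivAt_id (0 : ℝ)).smul_const (N z)).const_add z
      have hψd : HasDerivAt (fun s : ℝ => ψ (z + s • N z)) 1 0 := by
        have := h.hasDerivAt_comp hd (by simpa using hzB)
        rwa [zero_smul, add_zero, real_inner_self_eq_norm_sq, h.norm_eq_one z hzB, one_pow] at this
      have hlin : ∀ᶠ t : ℝ in 𝓝 0, 0 ≤ t → ψ (z + t • N z) - ψ z ≤ k * t := by
        filter_upwards [hloc] with t ht ht0
        have : ‖z + t • N z - x‖ ≤ ‖z - x‖ + t := by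
          have e : z + t • N z - x = (z - x) + t • N z := by abel
          rw [e]
          refine (norm_add_le _ _).trans ?_
          rw [norm_smul, h.norm_eq_one z hzB, mul_one, Real.norm_of_nonneg ht0]
        nlinarith [mul_le_mul_of_nonneg_left this hk0]
      have hslope := (hasDerivWithinAt_iff_tendsto_slope' (s := Ioi (0 : ℝ)) (by simp)).1
        (hψd.hasDerivWithinAt (s := Ioi 0))
      have : (1 : ℝ) ≤ k := by
        refine le_of_tendsto hslope ?_
        filter_upwards [nhdsWithin_le_nhds hlin, self_mem_nhdsWithin] with t ht ht0
        have ht0' : (0 : ℝ) < t := ht0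
        rw [slope_def_field]
        simp only [zero_smul, add_zero, sub_zero]
        rw [div_le_iff₀ ht0']
        exact ht ht0'.le
      linarith
    · have h1 : ψ x - k * ‖x - x‖ ≤ ψ z - k * ‖z - x‖ := hzmax (mem_closedBall_self hr.le)
      have h2 : ψ z ≤ ψ m := hmax (mem_sphere_iff_norm.2 heq)
      rw [sub_self, norm_zero, heq] at h1
      linarith
  have hge : ψ x + r ≤ ψ m := by
    have ht : Tendsto (fun k : ℝ => ψ x + k * r) (𝓝[<] 1) (𝓝 (ψ x + 1 * r)) := by
      have : Continuous fun k : ℝ => ψ x + k * r := by fun_prop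
      exact (this.tendsto 1).mono_left nhdsWithin_le_nhds
    rw [one_mul] at ht
    refine le_of_tendsto ht ?_
    filter_upwards [Ioo_mem_nhdsLT (show (0 : ℝ) < 1 by norm_num)] with k hk
    exact key k hk.1.le hk.2
  have hle := h.sub_le hB hxB (hxr (sphere_subset_closedBall hm))
  refine ⟨r⁻¹ • (m - x), ?_, ?_⟩
  · rw [norm_smul, hmr, norm_inv, Real.norm_of_nonneg hr.le, inv_mul_cancel₀ hr.ne']
  · rw [smul_smul, mul_inv_cancel₀ hr.ne', one_smul, add_sub_cancel]
    linarith

/-- At its starting point, a segment of unit growth has the direction of the gradient, so the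
direction found by maximizing on the sphere must be `N x`. -/
theorem eq_along_ray [ProperSpace E] (h : IsSolution ψ N B) (hB : Convex ℝ B) {x : E} {r : ℝ}
    (hxr : closedBall x r ⊆ B) {t : ℝ} (ht0 : 0 ≤ t) (htr : t ≤ r) :
    ψ (x + t • N x) = ψ x + t ∧ N (x + t • N x) = N x := by
  rcases (ht0.trans htr).eq_or_lt with h0 | hr
  · obtain rfl : t = 0 := le_antisymm (htr.trans h0.ge) ht0
    simp
  obtain ⟨w, hw, hψ⟩ := h.exists_unit_growth hB hr hxr
  have hx : x ∈ B := hxr (mem_closedBall_self hr.le)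
  have hxr' : x + r • w ∈ B := hxr (by simp [hw, norm_smul, abs_of_pos hr])
  have e : N x = w := by
    simpa using (h.eq_of_unit_growth hB hr hw hx hxr' hψ (t := 0) ⟨le_rfl, hr.le⟩).2
  rw [e]
  exact h.eq_of_unit_growth hB hr hw hx hxr' hψ ⟨ht0, htr⟩

/-- The gradient is constant along the straight line that it spans. -/
theorem eq_along_line [ProperSpace E] (h : IsSolution ψ N B) (hB : Convex ℝ B) {x : E} {r : ℝ}
    (hxr : closedBall x r ⊆ B) {t : ℝ} (ht : |t| ≤ r) :
    ψ (x + t • N x) = ψ x + t ∧ N (x + t • N x) = N x := by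
  rcases le_total 0 t with h0 | h0
  · exact h.eq_along_ray hB hxr h0 ((le_abs_self t).trans ht)
  · have := h.neg.eq_along_ray hB hxr (neg_nonneg.2 h0) ((neg_le_abs t).trans ht)
    simp only [smul_neg, neg_smul, neg_neg, neg_inj] at this
    exact ⟨by linarith [this.1], this.2⟩

/-- The point `x - r • N x` lies on the gradient line, at height `ψ x - r`. Hence the distance from
it, shifted by that height, bounds `ψ` from above and touches it at `x`; the inequality `2 r ‖v‖ ≤
‖v‖² + r²` turns this cone into a paraboloid. -/
theorem le_quadratic [ProperSpace E] (h : IsSolution ψ N B) (hB : Convex ℝ B) {x z : E} {r : ℝ}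
    (hr : 0 < r) (hxr : closedBall x r ⊆ B) (hz : z ∈ B) :
    ψ z ≤ ψ x + inner ℝ (N x) (z - x) + ‖z - x‖ ^ 2 / (2 * r) := by
  have hx : x ∈ B := hxr (mem_closedBall_self hr.le)
  have hN1 := h.norm_eq_one x hx
  have hy : x + (-r) • N x ∈ B := hxr (by simp [hN1, norm_smul, abs_of_pos hr])
  have h1 := h.sub_le hB hy hz
  rw [(h.eq_along_line hB hxr (t := -r) (by simp [abs_of_pos hr])).1] at h1
  have e : z - (x + (-r) • N x) = (z - x) + r • N x := by rw [neg_smul]; abel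
  rw [e] at h1
  have h2 : ‖(z - x) + r • N x‖ ^ 2 = ‖z - x‖ ^ 2 + 2 * (r * inner ℝ (N x) (z - x)) + r ^ 2 := by
    rw [norm_add_sq_real, norm_smul, hN1, mul_one, Real.norm_of_nonneg hr.le, real_inner_smul_right,
      real_inner_comm]
  have h3 : ‖(z - x) + r • N x‖ ≤ (‖(z - x) + r • N x‖ ^ 2 + r ^ 2) / (2 * r) := by
    rw [le_div_iff₀ (by positivity)]
    nlinarith [sq_nonneg (‖(z - x) + r • N x‖ - r)]
  have h4 : (‖(z - x) + r • N x‖ ^ 2 + r ^ 2) / (2 * r)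
      = r + inner ℝ (N x) (z - x) + ‖z - x‖ ^ 2 / (2 * r) := by
    rw [h2]; field_simp; ring
  linarith

theorem quadratic_le [ProperSpace E] (h : IsSolution ψ N B) (hB : Convex ℝ B) {x z : E} {r : ℝ}
    (hr : 0 < r) (hxr : closedBall x r ⊆ B) (hz : z ∈ B) :
    ψ x + inner ℝ (N x) (z - x) - ‖z - x‖ ^ 2 / (2 * r) ≤ ψ z := by
  have := h.neg.le_quadratic hB hr hxr hz
  rw [inner_neg_left] at this
  linarith

/-- The gradient of a solution of the eikonal equation is locally Lipschitz. -/
theorem norm_sub_le [ProperSpace E] (h : IsSolution ψ N B) (hB : Convex ℝ B) {x y : E} {r : ℝ}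
    (hr : 0 < r) (hxr : closedBall x r ⊆ B) (hyr : closedBall y r ⊆ B) (hxy : ‖y - x‖ ≤ r) :
    ‖N y - N x‖ ≤ 3 / r * ‖y - x‖ := by
  rcases (norm_nonneg (N y - N x)).eq_or_lt with h0 | h0
  · rw [← h0]; positivity
  set D := ‖N y - N x‖ with hD
  set ρ := ‖y - x‖ with hρ
  have hρ0 : 0 ≤ ρ := norm_nonneg _
  -- The displacement of length `ρ` from `y` that best separates the two gradients. Bounding `ψ (y +
  -- e)` below from `y` and above from `x`, and `ψ y` below from `x`, leaves errors `1/2`, `2` and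
  -- `1/2` times `ρ²/r`, whence the constant 3.
  set e : E := (ρ / D) • (N y - N x) with he
  have hen : ‖e‖ = ρ := by
    rw [he, norm_smul, ← hD, Real.norm_of_nonneg (by positivity), div_mul_cancel₀ _ h0.ne']
  have hyB : y ∈ B := hyr (mem_closedBall_self hr.le)
  have hye : y + e ∈ B := hyr (by simp [hen, hxy])
  have h1 := h.quadratic_le hB hr hyr hye
  have h2 := h.le_quadratic hB hr hxr hye
  have h3 := h.quadratic_le hB hr hxr hyB
  have e1 : y + e - x = (y - x) + e := by abel
  rw [add_sub_cancel_left, hen] at h1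
  rw [e1, inner_add_right] at h2
  rw [← hρ] at h3
  have h4 : ‖(y - x) + e‖ ^ 2 ≤ (2 * ρ) ^ 2 := by
    gcongr
    calc ‖(y - x) + e‖ ≤ ‖y - x‖ + ‖e‖ := norm_add_le _ _
      _ = 2 * ρ := by rw [hen, ← hρ]; ring
  have h5 : inner ℝ (N y) e - inner ℝ (N x) e = ρ * D := by
    rw [← inner_sub_left, he, real_inner_smul_right, real_inner_self_eq_norm_sq, ← hD]
    field_simp
  have h6 : ‖(y - x) + e‖ ^ 2 / (2 * r) ≤ (2 * ρ) ^ 2 / (2 * r) := by gcongr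
  have h7 : ρ * D ≤ 3 * ρ ^ 2 / r := by
    have : 3 * ρ ^ 2 / r = ρ ^ 2 / (2 * r) + ρ ^ 2 / (2 * r) + (2 * ρ) ^ 2 / (2 * r) := by
      field_simp; ring
    linarith
  rcases hρ0.eq_or_lt with hz | hpos
  · have : y = x := by
      rw [← sub_eq_zero, ← norm_eq_zero, ← hρ, ← hz]
    rw [hD, this, sub_self, norm_zero] at h0
    exact absurd h0 (lt_irrefl _)
  · have : ρ * D ≤ ρ * (3 / r * ρ) := by
      refine h7.trans (le_of_eq ?_)
      ring
    exact le_of_mul_le_mul_left this hpos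

/-- The gradient is constant along each of its integral curves. -/
theorem eq_along_integralCurve (h : IsSolution ψ N B) (hB : Convex ℝ B) {c : ℝ → E} {a b : ℝ}
    (hab : a < b) (hc : ∀ t ∈ Icc a b, HasDerivAt c (N (c t)) t) (hcB : MapsTo c (Icc a b) B) :
    N (c b) = N (c a) := by
  have ha : a ∈ Icc a b := left_mem_Icc.2 hab.le
  have hb : b ∈ Icc a b := right_mem_Icc.2 hab.le
  have hψ : ψ (c b) - ψ (c a) = b - a := by
    have hd : ∀ t ∈ Icc a b, HasDerivAt (fun s => ψ (c s) - s) 0 t := by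
      intro t ht
      have := (h.hasDerivAt_comp (hc t ht) (hcB ht)).fun_sub (hasDerivAt_id' t)
      rwa [real_inner_self_eq_norm_sq, h.norm_eq_one _ (hcB ht), one_pow, sub_self] at this
    have := (convex_Icc a b).norm_image_sub_le_of_norm_hasDerivWithin_le (C := 0)
      (fun t ht => (hd t ht).hasDerivWithinAt) (by simp) ha hb
    rw [zero_mul, norm_le_zero_iff] at this
    linarith
  have hn : ‖c b - c a‖ ≤ b - a := by
    have := (convex_Icc a b).norm_image_sub_le_of_norm_hasDerivWithin_le (C := 1)
      (fun t ht => (hc t ht).hasDerivWithinAt) (fun t ht => (h.norm_eq_one _ (hcB ht)).le) ha hb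
    rwa [one_mul, Real.norm_of_nonneg (sub_nonneg.2 hab.le)] at this
  -- The curve has unit speed and `ψ` gains `b - a` along it, so the chord is as long as the curve
  -- and is itself a segment of unit growth.
  have hn' : ‖c b - c a‖ = b - a :=
    le_antisymm hn (hψ ▸ h.sub_le hB (hcB ha) (hcB hb))
  have hpos : 0 < b - a := sub_pos.2 hab
  have e : c a + (b - a) • ((b - a)⁻¹ • (c b - c a)) = c b := by
    rw [smul_smul, mul_inv_cancel₀ hpos.ne', one_smul, add_sub_cancel]
  have hw : ‖(b - a)⁻¹ • (c b - c a)‖ = 1 := by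
    rw [norm_smul, hn', norm_inv, Real.norm_of_nonneg hpos.le, inv_mul_cancel₀ hpos.ne']
  have key := fun t (ht : t ∈ Icc 0 (b - a)) => (h.eq_of_unit_growth hB hpos hw (hcB ha)
    (by rw [e]; exact hcB hb) (by rw [e]; linarith) ht).2
  have k0 := key 0 ⟨le_rfl, hpos.le⟩
  have k1 := key (b - a) ⟨hpos.le, le_rfl⟩
  rw [zero_smul, add_zero] at k0
  rw [e] at k1
  rw [k0, k1]

end IsSolution
end Eikonal

/-! ### Potentials of weakly divergence free planar fields -/

namespace HeisenbergGraph
open Metric Filter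
open scoped Topology Convolution

theorem inner_plane (v w : Plane) : inner ℝ v w = v 0 * w 0 + v 1 * w 1 := by
  simp [PiLp.inner_apply, Fin.sum_univ_two, mul_comm]

/-- A linear endomorphism of the plane with vanishing curl is symmetric. -/
theorem inner_map_comm_of_curl_eq_zero (T : Plane →L[ℝ] Plane)
    (hT : T (EuclideanSpace.single 0 1) 1 = T (EuclideanSpace.single 1 1) 0) (a b : Plane) :
    inner ℝ (T a) b = inner ℝ (T b) a := by
  have dec : ∀ v : Plane, v = v 0 • EuclideanSpace.single (0 : Fin 2) (1 : ℝ)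
      + v 1 • EuclideanSpace.single (1 : Fin 2) (1 : ℝ) := by
    intro v; ext i; fin_cases i <;> simp
  have comp : ∀ v i, T v i = v 0 * T (EuclideanSpace.single 0 1) i
      + v 1 * T (EuclideanSpace.single 1 1) i := by
    intro v i
    conv_lhs => rw [dec v]
    simp
  rw [inner_plane, inner_plane, comp a, comp a, comp b, comp b, hT]
  ring

/-- The reflected translate of a bump function is a test function. -/
theorem isTest_normed_sub {Ω : Set Plane} {x : Plane} (φ : ContDiffBump (0 : Plane))
    (h : closedBall x φ.rOut ⊆ Ω) : IsTest Ω (fun y => φ.normed volume (x - y)) := by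
  have hs : tsupport (fun y => φ.normed volume (x - y)) ⊆ closedBall x φ.rOut := by
    refine closure_minimal ?_ isClosed_closedBall
    intro y hy
    have : x - y ∈ ball (0 : Plane) φ.rOut := by
      rw [← φ.support_normed_eq (μ := volume)]; exact hy
    rw [mem_ball_zero_iff] at this
    rw [mem_closedBall_iff_norm']
    exact this.le
  exact ⟨φ.contDiff_normed.comp (contDiff_const.sub contDiff_id),
    (isCompact_closedBall x φ.rOut).of_isClosed_subset (isClosed_tsupport _) hs, hs.trans h⟩

theorem perp_apply_zero (v : Plane) : perp v 0 = v 1 := rfl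
theorem perp_apply_one (v : Plane) : perp v 1 = -v 0 := rfl

/-- The perpendicular map as a continuous linear map. -/
noncomputable def perpL : Plane →L[ℝ] Plane :=
  LinearMap.toContinuousLinearMap
    { toFun := perp
      map_add' := fun v w => by ext i; fin_cases i <;> simp [perp]; ring
      map_smul' := fun a v => by ext i; fin_cases i <;> simp [perp] }

theorem perpL_apply (v : Plane) : perpL v = perp v := rfl

/-- The mollification of a divergence free field, turned by a right angle, is closed. -/
theorem curl_mollified_eq_zero {Ω K : Set Plane} (hK : IsCompact K) (hKΩ : K ⊆ Ω)
    {V : Plane → Plane} (hV : ContinuousOn V K)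
    (hdiv : ∀ φ : Plane → ℝ, IsTest Ω φ →
      ∫ z in Ω, (V z 0 * partialDeriv 0 φ z + V z 1 * partialDeriv 1 φ z) = 0)
    (φ : ContDiffBump (0 : Plane)) {x : Plane} (hx : closedBall x φ.rOut ⊆ K) :
    ∃ T : Plane →L[ℝ] Plane,
      HasFDerivAt (φ.normed volume ⋆[ContinuousLinearMap.lsmul ℝ ℝ, volume]
        K.indicator (fun z => perp (V z))) T x ∧
      T (EuclideanSpace.single 0 1) 1 = T (EuclideanSpace.single 1 1) 0 := by
  set g : Plane → Plane := K.indicator (fun z => perp (V z)) with hg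
  have hgi : LocallyIntegrable g volume := by
    refine Integrable.locallyIntegrable ?_
    rw [hg, integrable_indicator_iff hK.measurableSet]
    exact (perpL.continuous.comp_continuousOn hV).integrableOn_compact hK
  have hφ1 : ContDiff ℝ 1 (φ.normed (volume : Measure Plane)) := φ.contDiff_normed
  set L := (ContinuousLinearMap.lsmul ℝ ℝ : ℝ →L[ℝ] Plane →L[ℝ] Plane)
  set D := fderiv ℝ (φ.normed (volume : Measure Plane)) with hD
  have hDc : Continuous D := hφ1.continuous_fderiv one_ne_zero
  refine ⟨_, φ.hasCompactSupport_normed.hasFDerivAt_convolution_left L hφ1 hgi x, ?_⟩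
  have hint : Integrable (fun t => L.precompL Plane (D (x - t)) (g t)) volume := by
    have := (φ.hasCompactSupport_normed (μ := volume)).fderiv (𝕜 := ℝ)
      |>.convolutionExists_left (L.precompL Plane) hDc hgi x
    exact this.integrable_swap
  have hcomp : ∀ (e : Plane) (i : Fin 2),
      Integrable (fun t => D (x - t) e * g t i) volume ∧
      (D ⋆[L.precompL Plane, volume] g) x e i = ∫ t, D (x - t) e * g t i := by
    intro e i
    let A : (Plane →L[ℝ] Plane) →L[ℝ] ℝ :=
      (EuclideanSpace.proj i).comp (ContinuousLinearMap.apply ℝ Plane e)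
    have hA : ∀ t, A (L.precompL Plane (D (x - t)) (g t)) = D (x - t) e * g t i := by
      intro t
      simp [A, L, ContinuousLinearMap.precompL_apply]
    refine ⟨by simpa only [hA] using A.integrable_comp hint, ?_⟩
    have := A.integral_comp_comm hint
    simp only [hA] at this
    rw [this, convolution_eq_swap]
    rfl
  have htest := isTest_normed_sub φ (hx.trans hKΩ)
  have hpart : ∀ i t, partialDeriv i (fun y => φ.normed volume (x - y)) t
      = -D (x - t) (EuclideanSpace.single i 1) := by
    intro i t
    have h1 : HasFDerivAt (fun y => φ.normed volume (x - y))
        ((D (x - t)).comp (-ContinuousLinearMap.id ℝ Plane)) t :=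
      ((hφ1.differentiable one_ne_zero (x - t)).hasFDerivAt).comp t
        ((hasFDerivAt_id t).const_sub x)
    rw [partialDeriv, h1.fderiv]
    simp
  -- The kernel centred at `x` lives inside `K`, so truncating the field to `K` does not affect the
  -- curl at `x`, which becomes the weak divergence tested on the translated kernel.
  have hzero : ∀ t ∉ K, D (x - t) = 0 := by
    intro t ht
    have : x - t ∉ tsupport (φ.normed (volume : Measure Plane)) := by
      rw [φ.tsupport_normed_eq, mem_closedBall_zero_iff]
      intro hle
      exact ht (hx (mem_closedBall_iff_norm'.2 hle))
    exact image_eq_zero_of_notMem_tsupport fun h => this (tsupport_fderiv_subset ℝ h)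
  have h0 := hdiv _ htest
  rw [setIntegral_eq_integral_of_forall_compl_eq_zero] at h0
  · obtain ⟨i0, e0⟩ := hcomp (EuclideanSpace.single 0 1) 1
    obtain ⟨i1, e1⟩ := hcomp (EuclideanSpace.single 1 1) 0
    rw [e0, e1, ← sub_eq_zero, ← integral_sub i0 i1, ← h0]
    refine integral_congr_ae (Eventually.of_forall fun t => ?_)
    simp only [hpart]
    by_cases ht : t ∈ K
    · simp only [hg, indicator_of_mem ht, perp_apply_one, perp_apply_zero]
      ring
    · simp [hzero t ht]
  · intro t ht
    rw [hpart, hpart, hzero t fun h => ht (hKΩ h)]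
    simp

/-- A continuous planar field with vanishing weak divergence is, up to a right angle, locally a
gradient. -/
theorem exists_potential {Ω : Set Plane} {V : Plane → Plane} (hV : ContinuousOn V Ω)
    (hdiv : ∀ φ : Plane → ℝ, IsTest Ω φ →
      ∫ z in Ω, (V z 0 * partialDeriv 0 φ z + V z 1 * partialDeriv 1 φ z) = 0)
    {z₀ : Plane} {R R' : ℝ} (hRR' : R < R') (hball : closedBall z₀ R' ⊆ Ω) :
    ∃ ψ : Plane → ℝ, ∀ x ∈ ball z₀ R, HasFDerivAt ψ (innerSL ℝ (perp (V x))) x := by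
  set K := closedBall z₀ R'
  have hK : IsCompact K := isCompact_closedBall z₀ R'
  have hVK := hV.mono hball
  have hNK : ContinuousOn (fun z => perp (V z)) K := perpL.continuous.comp_continuousOn hVK
  have hUC := hK.uniformContinuousOn_of_continuous hNK
  set g : Plane → Plane := K.indicator (fun z => perp (V z)) with hg
  have hgm : AEStronglyMeasurable g volume := by
    have : Integrable g volume := by
      rw [hg, integrable_indicator_iff hK.measurableSet]
      exact hNK.integrableOn_compact hK
    exact this.aestronglyMeasurable
  have approx : ∀ ε > 0, ∃ (f : Plane → ℝ) (G : Plane → Plane), f z₀ = 0 ∧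
      (∀ x ∈ ball z₀ R, HasFDerivAt f (innerSL ℝ (G x)) x) ∧
      ∀ x ∈ ball z₀ R, dist (G x) (perp (V x)) ≤ ε := by
    intro ε hε
    obtain ⟨δ, hδ, hδ'⟩ := Metric.uniformContinuousOn_iff.1 hUC ε hε
    -- Kernel radius: `δ` controls the oscillation of the field, and `R' - R` keeps the kernel
    -- inside `K`.
    set m := min δ (R' - R)
    have hm : 0 < m := lt_min hδ (sub_pos.2 hRR')
    let φ : ContDiffBump (0 : Plane) := ⟨m / 2, m, half_pos hm, half_lt_self hm⟩
    have hsub : ∀ x ∈ ball z₀ R, closedBall x φ.rOut ⊆ K := by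
      intro x hx
      refine closedBall_subset_closedBall' ?_
      have h1 : φ.rOut ≤ R' - R := min_le_right _ _
      have h2 := mem_ball.1 hx
      linarith
    set G := φ.normed volume ⋆[ContinuousLinearMap.lsmul ℝ ℝ, volume] g with hG
    have hT : ∀ x ∈ ball z₀ R, ∃ T : Plane →L[ℝ] Plane, HasFDerivAt G T x ∧
        T (EuclideanSpace.single 0 1) 1 = T (EuclideanSpace.single 1 1) 0 := fun x hx =>
      curl_mollified_eq_zero hK hball hVK hdiv φ (hsub x hx)
    have hω : ∀ x ∈ ball z₀ R, ∀ T, HasFDerivAt G T x →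
        HasFDerivAt (fun y => innerSL ℝ (G y)) ((innerSL ℝ).comp T) x := fun x hx T h =>
      (innerSL ℝ (E := Plane)).hasFDerivAt.comp x h
    have hdiff : DifferentiableOn ℝ (fun y => innerSL ℝ (G y)) (ball z₀ R) := fun x hx => by
      obtain ⟨T, h, -⟩ := hT x hx
      exact (hω x hx T h).differentiableAt.differentiableWithinAt
    obtain ⟨f, hf⟩ := (convex_ball z₀ R).exists_forall_hasFDerivAt_of_fderiv_symmetric isOpen_ball
      hdiff
      (fun x hx a b => by
        obtain ⟨T, h, hc⟩ := hT x hx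
        rw [(hω x hx T h).fderiv]
        exact inner_map_comm_of_curl_eq_zero T hc a b)
    -- Normalizing at `z₀` makes the potentials converge at one point, so that uniform convergence
    -- of the gradients yields a limit potential.
    refine ⟨fun x => f x - f z₀, G, sub_self _, fun x hx => (hf x hx).sub_const _, fun x hx => ?_⟩
    have hxK : x ∈ K := hsub x hx (mem_closedBall_self φ.rOut_pos.le)
    have hgx : g x = perp (V x) := indicator_of_mem hxK _
    rw [← hgx]
    refine φ.dist_normed_convolution_le hgm fun y hy => ?_
    have hyK : y ∈ K := hsub x hx (ball_subset_closedBall hy)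
    rw [hgx, hg, indicator_of_mem hyK]
    exact (hδ' y hyK x hxK (hy.trans_le (min_le_left _ _))).le
  choose f G hf0 hfd hGd using fun n : ℕ => approx (1 / (n + 1)) Nat.one_div_pos_of_nat
  have hunif : TendstoUniformlyOn (fun n x => innerSL ℝ (G n x)) (fun x => innerSL ℝ (perp (V x)))
      atTop (ball z₀ R) := by
    rw [Metric.tendstoUniformlyOn_iff]
    intro ε hε
    have := (tendsto_one_div_add_atTop_nhds_zero_nat (𝕜 := ℝ)).eventually (gt_mem_nhds hε)
    filter_upwards [this] with n hn x hx
    have h1 : dist (innerSL ℝ (perp (V x))) (innerSL ℝ (G n x)) = dist (G n x) (perp (V x)) := by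
      rw [dist_eq_norm, ← map_sub, innerSL_apply_norm, dist_comm, dist_eq_norm]
    rw [h1]
    exact (hGd n x hx).trans_lt hn
  have hcauchy := uniformCauchySeqOn_ball_of_fderiv hunif.uniformCauchySeqOn
    (fun n x hx => hfd n x hx) (by simpa only [hf0] using (tendsto_const_nhds).cauchy_map)
  refine ⟨fun x => lim (map (fun n => f n x) atTop), fun x hx => ?_⟩
  exact hasFDerivAt_of_tendstoUniformlyOn isOpen_ball hunif (fun n x hx => hfd n x hx)
    (fun y hy => (hcauchy.cauchy_map hy).le_nhds_lim) hx

end HeisenbergGraph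

/-! ### Families of lines over a curve, and differentiability of the tangent -/

namespace HeisenbergGraph
open Metric Filter Asymptotics
open scoped Topology

theorem perp_perp (v : Plane) : perp (perp v) = -v := by
  ext i; fin_cases i <;> simp [perp]

theorem norm_perp (v : Plane) : ‖perp v‖ = ‖v‖ := by
  rw [EuclideanSpace.norm_eq, EuclideanSpace.norm_eq, Fin.sum_univ_two, Fin.sum_univ_two,
    perp_apply_zero, perp_apply_one, norm_neg, add_comm]

theorem perp_sub (v w : Plane) : perp v - perp w = perp (v - w) := by
  simp only [← perpL_apply, map_sub]

theorem perp_injective : Function.Injective perp := fun v w h => by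
  have := congrArg perp h
  rwa [perp_perp, perp_perp, neg_inj] at this

theorem inner_perp_self (v : Plane) : inner ℝ (perp v) v = 0 := by
  rw [inner_plane, perp_apply_zero, perp_apply_one]; ring

theorem eq_inner_smul_add_inner_perp_smul {n : Plane} (hn : ‖n‖ = 1) (v : Plane) :
    v = inner ℝ n v • n + inner ℝ (perp n) v • perp n := by
  have h : n 0 ^ 2 + n 1 ^ 2 = 1 := by
    have := real_inner_self_eq_norm_sq n
    rw [hn, inner_plane] at this
    linarith
  ext i
  fin_cases i
  · simp only [Fin.zero_eta, PiLp.add_apply, PiLp.smul_apply, smul_eq_mul, inner_plane,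
      perp_apply_zero, perp_apply_one]
    linear_combination (-(v 0)) * h
  · simp only [Fin.mk_one, PiLp.add_apply, PiLp.smul_apply, smul_eq_mul, inner_plane,
      perp_apply_zero, perp_apply_one]
    linear_combination (-(v 1)) * h

/-- The coordinates of the plane in the orthonormal frame `(n, n^⊥)`. -/
noncomputable def frameEquiv (n : Plane) (hn : ‖n‖ = 1) : (ℝ × ℝ) ≃L[ℝ] Plane :=
  ContinuousLinearEquiv.equivOfInverse
    ((ContinuousLinearMap.fst ℝ ℝ ℝ).smulRight n
      + (ContinuousLinearMap.snd ℝ ℝ ℝ).smulRight (perp n))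
    ((innerSL ℝ n).prod (innerSL ℝ (perp n)))
    (fun x => by
      have h1 : inner ℝ n (perp n) = 0 := by rw [real_inner_comm, inner_perp_self]
      ext <;> simp [inner_add_right, real_inner_smul_right, hn, h1, inner_perp_self, norm_perp])
    (fun v => by
      simpa using (eq_inner_smul_add_inner_perp_smul hn v).symm)

/-- A family of straight lines over a curve is strictly differentiable along the curve, although
the directions of the lines are merely Lipschitz. -/
theorem hasStrictFDerivAt_add_smul {γ m : ℝ → Plane} {s₀ : ℝ} {n : Plane} {C : ℝ} {U : Set ℝ}
    (hγ : HasStrictDerivAt γ n s₀) (hm : ContinuousAt m s₀) (hU : U ∈ 𝓝 s₀)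
    (hL : ∀ s ∈ U, ∀ s' ∈ U, ‖m s - m s'‖ ≤ C * |s - s'|) :
    HasStrictFDerivAt (fun x : ℝ × ℝ => γ x.1 + x.2 • m x.1)
      ((ContinuousLinearMap.fst ℝ ℝ ℝ).smulRight n
        + (ContinuousLinearMap.snd ℝ ℝ ℝ).smulRight (m s₀)) (s₀, 0) := by
  refine HasStrictFDerivAt.fun_add ?_ ?_
  · have h1 : HasStrictFDerivAt γ (ContinuousLinearMap.toSpanSingleton ℝ n) ((s₀, (0 : ℝ)).1) := hγ
    have := h1.comp (s₀, (0 : ℝ)) hasStrictFDerivAt_fst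
    refine this.congr_fderiv ?_
    ext <;> simp
  · rw [hasStrictFDerivAt_iff_isLittleO, isLittleO_iff]
    intro ε hε
    have t1 : Tendsto (fun p : (ℝ × ℝ) × (ℝ × ℝ) => p.1.1) (𝓝 ((s₀, 0), (s₀, 0))) (𝓝 s₀) :=
      (by fun_prop : Continuous fun p : (ℝ × ℝ) × (ℝ × ℝ) => p.1.1).tendsto _
    have t2 : Tendsto (fun p : (ℝ × ℝ) × (ℝ × ℝ) => p.2.1) (𝓝 ((s₀, 0), (s₀, 0))) (𝓝 s₀) :=
      (by fun_prop : Continuous fun p : (ℝ × ℝ) × (ℝ × ℝ) => p.2.1).tendsto _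
    have t3 : Tendsto (fun p : (ℝ × ℝ) × (ℝ × ℝ) => |p.2.2| * C) (𝓝 ((s₀, 0), (s₀, 0)))
        (𝓝 0) := by
      simpa using (by fun_prop : Continuous fun p : (ℝ × ℝ) × (ℝ × ℝ) => |p.2.2| * C).tendsto
        ((s₀, 0), (s₀, 0))
    have t4 : ∀ᶠ s in 𝓝 s₀, ‖m s - m s₀‖ < ε / 2 := by
      have := (continuous_norm.tendsto _).comp (hm.sub_const (m s₀))
      rw [sub_self, norm_zero] at this
      exact this.eventually (gt_mem_nhds (half_pos hε))
    filter_upwards [t1 hU, t2 hU, t1.eventually t4, t3.eventually (gt_mem_nhds (half_pos hε))]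
      with p h1 h2 h3 h4
    -- The first summand is small by continuity of `m`; in the second the Lipschitz bound is
    -- multiplied by a parameter tending to 0.
    have e : p.1.2 • m p.1.1 - p.2.2 • m p.2.1
        - ((ContinuousLinearMap.snd ℝ ℝ ℝ).smulRight (m s₀)) (p.1 - p.2)
        = (p.1.2 - p.2.2) • (m p.1.1 - m s₀) + p.2.2 • (m p.1.1 - m p.2.1) := by
      simp only [ContinuousLinearMap.smulRight_apply, ContinuousLinearMap.coe_snd', Prod.snd_sub]
      module
    rw [e]
    have n1 : |p.1.1 - p.2.1| ≤ ‖p.1 - p.2‖ := norm_fst_le (p.1 - p.2)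
    have n2 : |p.1.2 - p.2.2| ≤ ‖p.1 - p.2‖ := norm_snd_le (p.1 - p.2)
    calc _ ≤ |p.1.2 - p.2.2| * ‖m p.1.1 - m s₀‖ + |p.2.2| * ‖m p.1.1 - m p.2.1‖ := by
          refine (norm_add_le _ _).trans ?_
          rw [norm_smul, norm_smul, Real.norm_eq_abs, Real.norm_eq_abs]
      _ ≤ ‖p.1 - p.2‖ * (ε / 2) + |p.2.2| * (C * |p.1.1 - p.2.1|) := by
          gcongr
          exact hL _ h1 _ h2
      _ = ‖p.1 - p.2‖ * (ε / 2) + |p.2.2| * C * |p.1.1 - p.2.1| := by ring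
      _ ≤ ‖p.1 - p.2‖ * (ε / 2) + (ε / 2) * ‖p.1 - p.2‖ := by gcongr
      _ = ε * ‖p.1 - p.2‖ := by ring

theorem hasDerivAt_zero_of_isBigO_sq {f : ℝ → ℝ} {s₀ : ℝ}
    (h : f =O[𝓝 s₀] fun s => (s - s₀) * (s - s₀)) : HasDerivAt f 0 s₀ := by
  have : f =O[𝓝 s₀] fun s => ‖s - s₀‖ ^ 2 := by
    refine h.trans (isBigO_of_le _ fun s => ?_)
    simp [sq]
  simpa using (this.hasFDerivAt (𝕜 := ℝ) one_lt_two).hasDerivAt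

/-- If a graph is ruled along the normals of a curve with Lipschitz unit tangent `m`, then a
nondegeneracy condition at distance `r` from the curve makes `m` differentiable. -/
theorem hasDerivAt_tangent {u : Plane → ℝ} {γ m : ℝ → Plane} {s₀ r : ℝ} {L L₀ : Plane →L[ℝ] ℝ}
    (hγ : HasDerivAt γ (m s₀) s₀) (hm1 : ∀ᶠ s in 𝓝 s₀, ‖m s‖ = 1)
    (hmO : (fun s => m s - m s₀) =O[𝓝 s₀] fun s => s - s₀)
    (hruled : ∀ᶠ s in 𝓝 s₀,
      u (γ s + r • perp (m s)) = u (γ s) - r / 2 * inner ℝ (γ s) (m s))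
    (hL₀ : HasFDerivAt u L₀ (γ s₀)) (hL : HasFDerivAt u L (γ s₀ + r • perp (m s₀)))
    (hr : r ≠ 0) (hnd : inner ℝ (γ s₀) (perp (m s₀)) / 2 - L (m s₀) ≠ 0) :
    HasDerivAt m (((L₀ (m s₀) - r / 2 - L (m s₀)) /
      (r * (inner ℝ (γ s₀) (perp (m s₀)) / 2 - L (m s₀)))) • perp (m s₀)) s₀ := by
  have hn : ‖m s₀‖ = 1 := hm1.self_of_nhds
  set n := m s₀ with hndef
  have hγO : (fun s => γ s - γ s₀) =O[𝓝 s₀] fun s => s - s₀ := hγ.isBigO_sub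
  -- For unit vectors `‖m - n‖² = 2 (1 - ⟨n, m⟩)`, so the tangential component varies only to second
  -- order.
  have hαd : HasDerivAt (fun s => inner ℝ n (m s)) 0 s₀ := by
    have h1 : (fun s => inner ℝ n (m s) - 1) =O[𝓝 s₀] fun s => (s - s₀) * (s - s₀) := by
      refine IsBigO.trans (.of_bound 1 ?_) (hmO.norm_left.mul hmO.norm_left)
      filter_upwards [hm1] with s hs
      have : ‖m s - n‖ * ‖m s - n‖ = -2 * (inner ℝ n (m s) - 1) := by
        rw [← sq, norm_sub_sq_real, hs, hn, real_inner_comm]; ring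
      rw [this, norm_mul]
      have h2 : ‖(-2 : ℝ)‖ = 2 := by norm_num
      rw [h2]
      linarith [norm_nonneg (inner ℝ n (m s) - 1)]
    simpa using (hasDerivAt_zero_of_isBigO_sq h1).add_const 1
  have hqd : HasDerivAt (fun s => inner ℝ (γ s - γ s₀) (m s - n)) 0 s₀ := by
    refine hasDerivAt_zero_of_isBigO_sq (IsBigO.trans (.of_bound 1 (.of_forall fun s => ?_))
      (hγO.norm_left.mul hmO.norm_left))
    rw [one_mul, norm_mul, norm_norm, norm_norm]
    exact norm_inner_le_norm _ _
  set F : ℝ → Plane := fun s => γ s + r • perp (m s) with hF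
  have hFO : (fun s => F s - F s₀) =O[𝓝 s₀] fun s => s - s₀ := by
    have h1 : (fun s => r • perp (m s - n)) =O[𝓝 s₀] fun s => s - s₀ := by
      refine IsBigO.const_smul_left ?_ r
      refine IsBigO.trans (isBigO_of_le _ fun s => ?_) hmO
      rw [norm_perp]
    refine (hγO.add h1).congr_left fun s => ?_
    simp only [hF, ← perp_sub]
    module
  have hFt : Tendsto F (𝓝 s₀) (𝓝 (F s₀)) := by
    have h1 : Tendsto (fun s : ℝ => s - s₀) (𝓝 s₀) (𝓝 0) := by
      simpa using (continuous_sub_right s₀).tendsto s₀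
    have := (hFO.trans_tendsto h1).add_const (F s₀)
    simpa using this
  -- The Taylor remainder of `u` needs only `F s - F s₀ = O(s - s₀)`; differentiability of `F` is
  -- not yet available.
  have hEd : HasDerivAt (fun s => u (F s) - u (F s₀) - L (F s - F s₀)) 0 s₀ := by
    refine HasDerivAt.of_isLittleO ?_
    have := (hL.isLittleO.comp_tendsto hFt).trans_isBigO hFO
    simpa only [Function.comp_def, sub_self, map_zero, sub_zero, smul_zero] using this
  have hud : HasDerivAt (fun s => u (γ s)) (L₀ n) s₀ := hL₀.comp_hasDerivAt s₀ hγ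
  have hLd : HasDerivAt (fun s => L (γ s)) (L n) s₀ := L.hasFDerivAt.comp_hasDerivAt s₀ hγ
  have hid : HasDerivAt (fun s => inner ℝ n (γ s - γ s₀)) 1 s₀ := by
    have := (innerSL ℝ n).hasFDerivAt.comp_hasDerivAt s₀ (hγ.sub_const (γ s₀))
    rw [innerSL_apply_apply, real_inner_self_eq_norm_sq, hn, one_pow] at this
    exact this
  -- the functional whose value on `m` is seen by the ruled graph
  let l : Plane →L[ℝ] ℝ := r • L.comp perpL + (r / 2) • innerSL ℝ (γ s₀)
  have hl : ∀ v, l v = r * L (perp v) + r / 2 * inner ℝ (γ s₀) v := fun v => by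
    simp [l, perpL_apply]
  have hld : HasDerivAt (fun s => l (m s)) (L₀ n - r / 2 - L n) s₀ := by
    have h1 := (((hud.fun_sub (hqd.const_mul (r / 2))).fun_sub (hid.const_mul (r / 2))).fun_sub
      hLd).fun_sub hEd |>.add_const (L (F s₀) - u (F s₀))
    have h2 : L₀ n - r / 2 * 0 - r / 2 * 1 - L n - 0 = L₀ n - r / 2 - L n := by ring
    rw [h2] at h1
    refine h1.congr_of_eventuallyEq ?_
    filter_upwards [hruled] with s hs
    have e1 : u (F s) = u (γ s) - r / 2 * inner ℝ (γ s) (m s) := hs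
    have e2 : L (F s - F s₀) = L (γ s) + r * L (perp (m s)) - L (F s₀) := by
      rw [map_sub]; simp [hF]
    have e3 : inner ℝ (γ s) (m s) = inner ℝ (γ s - γ s₀) (m s - n) + inner ℝ n (γ s - γ s₀)
        + inner ℝ (γ s₀) (m s) := by
      rw [inner_sub_left, inner_sub_right, inner_sub_right, inner_sub_right, real_inner_comm n,
        real_inner_comm n]
      ring
    rw [hl, e1, e2, e3]
    ring
  have hlN : l (perp n) = r * (inner ℝ (γ s₀) (perp n) / 2 - L n) := by
    rw [hl, perp_perp, map_neg]; ring
  have hc : l (perp n) ≠ 0 := by rw [hlN]; exact mul_ne_zero hr hnd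
  -- Apply `l` to the decomposition of `m s` in the frame `(n, perp n)` and solve for the normal
  -- component.
  have hβ : ∀ s, inner ℝ (perp n) (m s) = (l (m s) - inner ℝ n (m s) * l n) / l (perp n) := by
    intro s
    rw [eq_div_iff hc]
    have := congrArg l (eq_inner_smul_add_inner_perp_smul hn (m s))
    rw [map_add, map_smul, map_smul, smul_eq_mul, smul_eq_mul] at this
    linarith
  have hβd : HasDerivAt (fun s => inner ℝ (perp n) (m s))
      ((L₀ n - r / 2 - L n) / l (perp n)) s₀ := by
    have := (hld.fun_sub (hαd.mul_const (l n))).div_const (l (perp n))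
    rw [zero_mul, sub_zero] at this
    exact this.congr_of_eventuallyEq (.of_forall hβ)
  have := (hαd.smul_const n).fun_add (hβd.smul_const (perp n))
  rw [zero_smul, zero_add, hlN] at this
  exact this.congr_of_eventuallyEq
    (.of_forall fun s => eq_inner_smul_add_inner_perp_smul hn (m s))

end HeisenbergGraph

/-! ### The horizontal Gauss map of a graph -/

namespace HeisenbergGraph
open Metric Filter Asymptotics
open scoped Topology

section GaussMap

variable {Ω : Set Plane} {u : Plane → ℝ}

theorem differentiableAt_of_contDiffOn (hΩ : IsOpen Ω) (hu : ContDiffOn ℝ 1 u Ω) {z : Plane}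
    (hz : z ∈ Ω) : DifferentiableAt ℝ u z :=
  (hu.differentiableOn one_ne_zero).differentiableAt (hΩ.mem_nhds hz)

theorem fderiv_height_sub {z : Plane} (hz : DifferentiableAt ℝ u z) (t : ℝ) (v : Heis) :
    fderiv ℝ (fun P : Heis => P.2 - u P.1) (z, t) v = v.2 - fderiv ℝ u z v.1 := by
  have h1 : HasFDerivAt (fun P : Heis => u P.1)
      ((fderiv ℝ u z).comp (ContinuousLinearMap.fst ℝ Plane ℝ)) (z, t) :=
    HasFDerivAt.comp (z, t) (f := fun P : Heis => P.1) hz.hasFDerivAt hasFDerivAt_fst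
  have h2 : HasFDerivAt (fun P : Heis => P.2 - u P.1) _ (z, t) := hasFDerivAt_snd.fun_sub h1
  rw [h2.fderiv]
  rfl

theorem gaussP_eq {z : Plane} (hz : DifferentiableAt ℝ u z) :
    gaussP u z = -(z 1) / 2 - fderiv ℝ u z !₂[1, 0] :=
  fderiv_height_sub hz (u z) (fieldX1 (z, u z))

theorem gaussQ_eq {z : Plane} (hz : DifferentiableAt ℝ u z) :
    gaussQ u z = z 0 / 2 - fderiv ℝ u z !₂[0, 1] :=
  fderiv_height_sub hz (u z) (fieldX2 (z, u z))

/-- The length of the horizontal Gauss map. -/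
noncomputable def gaussNorm (u : Plane → ℝ) (z : Plane) : ℝ :=
  Real.sqrt (gaussP u z ^ 2 + gaussQ u z ^ 2)

theorem gaussNorm_sq (z : Plane) : gaussNorm u z ^ 2 = gaussP u z ^ 2 + gaussQ u z ^ 2 :=
  Real.sq_sqrt (by positivity)

theorem gaussNorm_pos {z : Plane} (hz : ¬ IsCharacteristic u z) : 0 < gaussNorm u z := by
  refine Real.sqrt_pos.2 (lt_of_le_of_ne (by positivity) fun h => hz ⟨?_, ?_⟩)
  · nlinarith [sq_nonneg (gaussP u z), sq_nonneg (gaussQ u z)]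
  · nlinarith [sq_nonneg (gaussP u z), sq_nonneg (gaussQ u z)]

theorem gaussP_eq_mul {z : Plane} (hz : ¬ IsCharacteristic u z) :
    gaussP u z = gaussNorm u z * nuX u z 0 :=
  (mul_div_cancel₀ _ (gaussNorm_pos hz).ne').symm

theorem gaussQ_eq_mul {z : Plane} (hz : ¬ IsCharacteristic u z) :
    gaussQ u z = gaussNorm u z * nuX u z 1 :=
  (mul_div_cancel₀ _ (gaussNorm_pos hz).ne').symm

theorem norm_nuX {z : Plane} (hz : ¬ IsCharacteristic u z) : ‖nuX u z‖ = 1 := by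
  have h := gaussNorm_sq (u := u) z
  rw [gaussP_eq_mul hz, gaussQ_eq_mul hz] at h
  have h1 : nuX u z 0 ^ 2 + nuX u z 1 ^ 2 = 1 := by
    have : gaussNorm u z ^ 2 * (nuX u z 0 ^ 2 + nuX u z 1 ^ 2) = gaussNorm u z ^ 2 * 1 := by
      linarith
    exact mul_left_cancel₀ (pow_ne_zero 2 (gaussNorm_pos hz).ne') this
  rw [EuclideanSpace.norm_eq, Fin.sum_univ_two, Real.norm_eq_abs, Real.norm_eq_abs, sq_abs, sq_abs,
    h1, Real.sqrt_one]

theorem continuousOn_gaussP (hΩ : IsOpen Ω) (hu : ContDiffOn ℝ 1 u Ω) :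
    ContinuousOn (gaussP u) Ω := by
  have h := hu.continuousOn_fderiv_of_isOpen hΩ le_rfl
  have : ContinuousOn (fun z : Plane => -(z 1) / 2 - fderiv ℝ u z !₂[1, 0]) Ω :=
    (by fun_prop : Continuous fun z : Plane => -(z 1) / 2).continuousOn.sub
      (h.clm_apply continuousOn_const)
  exact this.congr fun z hz => gaussP_eq (differentiableAt_of_contDiffOn hΩ hu hz)

theorem continuousOn_gaussQ (hΩ : IsOpen Ω) (hu : ContDiffOn ℝ 1 u Ω) :
    ContinuousOn (gaussQ u) Ω := by
  have h := hu.continuousOn_fderiv_of_isOpen hΩ le_rfl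
  have : ContinuousOn (fun z : Plane => z 0 / 2 - fderiv ℝ u z !₂[0, 1]) Ω :=
    (by fun_prop : Continuous fun z : Plane => z 0 / 2).continuousOn.sub
      (h.clm_apply continuousOn_const)
  exact this.congr fun z hz => gaussQ_eq (differentiableAt_of_contDiffOn hΩ hu hz)

theorem continuousOn_gaussNorm (hΩ : IsOpen Ω) (hu : ContDiffOn ℝ 1 u Ω) :
    ContinuousOn (gaussNorm u) Ω :=
  (((continuousOn_gaussP hΩ hu).pow 2).add ((continuousOn_gaussQ hΩ hu).pow 2)).sqrt

theorem continuousOn_nuX (hΩ : IsOpen Ω) (hu : ContDiffOn ℝ 1 u Ω)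
    (hchar : ∀ z ∈ Ω, ¬ IsCharacteristic u z) : ContinuousOn (nuX u) Ω := by
  have hne : ∀ z ∈ Ω, gaussNorm u z ≠ 0 := fun z hz => (gaussNorm_pos (hchar z hz)).ne'
  refine (PiLp.continuous_toLp 2 _).comp_continuousOn (continuousOn_pi.2 fun i => ?_)
  fin_cases i
  · exact (continuousOn_gaussP hΩ hu).div (continuousOn_gaussNorm hΩ hu) hne
  · exact (continuousOn_gaussQ hΩ hu).div (continuousOn_gaussNorm hΩ hu) hne

theorem clm_apply_plane (L : Plane →L[ℝ] ℝ) (v : Plane) :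
    L v = v 0 * L !₂[1, 0] + v 1 * L !₂[0, 1] := by
  have : v = v 0 • !₂[(1 : ℝ), 0] + v 1 • !₂[(0 : ℝ), 1] := by
    ext i; fin_cases i <;> simp
  conv_lhs => rw [this]
  simp only [map_add, map_smul, smul_eq_mul]

/-- In the direction orthogonal to `(p, q)` the contribution of the Gauss map cancels, and only the
coefficients of the fields `X₁`, `X₂` remain. -/
theorem fderiv_perp_nuX {z : Plane} (hd : DifferentiableAt ℝ u z) (hz : ¬ IsCharacteristic u z) :
    fderiv ℝ u z (perp (nuX u z)) = -(1 / 2) * inner ℝ z (nuX u z) := by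
  have hp := gaussP_eq hd
  have hq := gaussQ_eq hd
  rw [gaussP_eq_mul hz] at hp
  rw [gaussQ_eq_mul hz] at hq
  rw [clm_apply_plane, perp_apply_zero, perp_apply_one, inner_plane]
  linear_combination nuX u z 1 * hp - nuX u z 0 * hq

/-- In the direction of `ν` itself the full length of `(p, q)` survives; its positivity supplies the
nondegeneracy needed for the regularity of seed curves. -/
theorem fderiv_nuX {z : Plane} (hd : DifferentiableAt ℝ u z) (hz : ¬ IsCharacteristic u z) :
    fderiv ℝ u z (nuX u z) = inner ℝ z (perp (nuX u z)) / 2 - gaussNorm u z := by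
  have hp := gaussP_eq hd
  have hq := gaussQ_eq hd
  rw [gaussP_eq_mul hz] at hp
  rw [gaussQ_eq_mul hz] at hq
  have h1 : nuX u z 0 ^ 2 + nuX u z 1 ^ 2 = 1 := by
    have := real_inner_self_eq_norm_sq (nuX u z)
    rw [norm_nuX hz, inner_plane] at this
    linarith
  rw [clm_apply_plane, inner_plane, perp_apply_zero, perp_apply_one]
  linear_combination nuX u z 0 * hp + nuX u z 1 * hq - gaussNorm u z * h1

/-! ### Straight rulings and existence of seed curves -/

/-- Near every point, the perpendicular of the Gauss map of an H-minimal graph is the gradient of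
a solution of the eikonal equation. -/
theorem exists_isSolution (hΩ : IsOpen Ω) (hu : ContDiffOn ℝ 1 u Ω)
    (hchar : ∀ z ∈ Ω, ¬ IsCharacteristic u z) (hmin : IsHMinimal u Ω) {z₀ : Plane}
    (hz₀ : z₀ ∈ Ω) :
    ∃ ρ > 0, ball z₀ (3 * ρ) ⊆ Ω ∧
      ∃ ψ, Eikonal.IsSolution ψ (fun z => perp (nuX u z)) (ball z₀ (3 * ρ)) := by
  obtain ⟨ε, hε, hsub⟩ := nhds_basis_closedBall.mem_iff.1 (hΩ.mem_nhds hz₀)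
  have hlt : 3 * (ε / 6) < ε := by linarith
  have hball : ball z₀ (3 * (ε / 6)) ⊆ Ω :=
    (ball_subset_closedBall.trans (closedBall_subset_closedBall hlt.le)).trans hsub
  obtain ⟨ψ, hψ⟩ := exists_potential (continuousOn_nuX hΩ hu hchar) hmin hlt hsub
  exact ⟨ε / 6, by positivity, hball, ψ, hψ, fun x hx => by
    rw [norm_perp, norm_nuX (hchar x (hball hx))]⟩

/-- Near every point, the Gauss map of an H-minimal graph is Lipschitz, and constant along the
straight lines perpendicular to it. -/
theorem exists_ruling (hΩ : IsOpen Ω) (hu : ContDiffOn ℝ 1 u Ω)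
    (hchar : ∀ z ∈ Ω, ¬ IsCharacteristic u z) (hmin : IsHMinimal u Ω) {z₀ : Plane}
    (hz₀ : z₀ ∈ Ω) :
    ∃ ρ > 0, ball z₀ ρ ⊆ Ω ∧
      (∀ x ∈ ball z₀ ρ, ∀ t : ℝ, |t| ≤ ρ → x + t • perp (nuX u x) ∈ Ω ∧
        nuX u (x + t • perp (nuX u x)) = nuX u x) ∧
      ∃ C : NNReal, LipschitzOnWith C (nuX u) (ball z₀ ρ) := by
  obtain ⟨ρ, hρ, hball, ψ, hψ⟩ := exists_isSolution hΩ hu hchar hmin hz₀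
  -- The radius `2ρ` also bounds the distance between two points of `ball z₀ ρ`, as the Lipschitz
  -- estimate requires.
  have hcl : ∀ x ∈ ball z₀ ρ, closedBall x (2 * ρ) ⊆ ball z₀ (3 * ρ) := fun x hx =>
    closedBall_subset_ball' (by linarith [mem_ball.1 hx])
  refine ⟨ρ, hρ, (ball_subset_ball (by linarith)).trans hball, fun x hx t ht => ⟨?_, ?_⟩,
    ⟨3 / (2 * ρ), by positivity⟩, ?_⟩
  · refine hball (hcl x hx ?_)
    have hxΩ : x ∈ Ω := hball (hcl x hx (mem_closedBall_self (by positivity)))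
    rw [mem_closedBall_iff_norm, add_sub_cancel_left, norm_smul, norm_perp,
      norm_nuX (hchar x hxΩ), mul_one, Real.norm_eq_abs]
    linarith
  · exact perp_injective
      (hψ.eq_along_line (convex_ball _ _) (hcl x hx) (ht.trans (by linarith))).2
  · refine LipschitzOnWith.of_dist_le_mul fun x hx y hy => ?_
    have h1 := hψ.norm_sub_le (convex_ball _ _) (r := 2 * ρ) (by positivity) (hcl y hy) (hcl x hx)
      (by
        rw [← dist_eq_norm]
        linarith [dist_triangle_right x y z₀, mem_ball.1 hx, mem_ball.1 hy])
    rw [perp_sub, norm_perp] at h1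
    rw [dist_eq_norm, dist_eq_norm]
    exact h1

/-- The graph of `u` is ruled by straight lines over the perpendiculars of the Gauss map. -/
theorem height_along_ruling (hΩ : IsOpen Ω) (hu : ContDiffOn ℝ 1 u Ω)
    (hchar : ∀ z ∈ Ω, ¬ IsCharacteristic u z) {x : Plane} {ρ : ℝ}
    (hx : ∀ t : ℝ, |t| ≤ ρ → x + t • perp (nuX u x) ∈ Ω ∧
      nuX u (x + t • perp (nuX u x)) = nuX u x) {r : ℝ} (hr : |r| ≤ ρ) :
    u (x + r • perp (nuX u x)) = u x - r / 2 * inner ℝ x (nuX u x) := by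
  set n := nuX u x with hn
  have hd : ∀ t ∈ Icc (-ρ) ρ, HasDerivAt (fun s : ℝ => u (x + s • perp n)
      + s * (1 / 2 * inner ℝ x n)) 0 t := by
    intro t ht
    obtain ⟨hy, hy'⟩ := hx t (abs_le.2 ht)
    have hdy := differentiableAt_of_contDiffOn hΩ hu hy
    have h1 : HasDerivAt (fun s : ℝ => x + s • perp n) (perp n) t := by
      simpa using ((hasDerivAt_id t).smul_const (perp n)).const_add x
    have h2 := (hdy.hasFDerivAt.comp_hasDerivAt t h1).add
      ((hasDerivAt_id t).mul_const (1 / 2 * inner ℝ x n))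
    have h3 := fderiv_perp_nuX hdy (hchar _ hy)
    -- Moving along `perp n` leaves the inner product with `n` unchanged, so the slope of `u` is
    -- constant on the ruling.
    rw [hy', inner_add_left, real_inner_smul_left, inner_perp_self] at h3
    rw [h3] at h2
    exact h2.congr_deriv (by ring)
  have := (convex_Icc (-ρ) ρ).norm_image_sub_le_of_norm_hasDerivWithin_le (C := 0)
    (fun t ht => (hd t ht).hasDerivWithinAt) (by simp)
    (abs_le.1 (abs_zero.trans_le ((abs_nonneg r).trans hr))) (abs_le.1 hr)
  simp only [zero_mul, norm_le_zero_iff, zero_smul, add_zero] at this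
  linarith

/-- Integral curves of the perpendicular of the Gauss map are straight lines. -/
theorem eq_line_of_isCurveIn_perp (hΩ : IsOpen Ω) (hu : ContDiffOn ℝ 1 u Ω)
    (hchar : ∀ z ∈ Ω, ¬ IsCharacteristic u z) (hmin : IsHMinimal u Ω) {I : Set ℝ} {c : ℝ → Plane}
    (hc : IsCurveIn Ω (fun z => perp (nuX u z)) I c) {t₀ t : ℝ} (ht₀ : t₀ ∈ I) (ht : t ∈ I) :
    c t = c t₀ + (t - t₀) • perp (nuX u (c t₀)) := by
  have hder : ∀ t ∈ I, HasDerivAt c (perp (nuX u (c t))) t := fun t ht =>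
    (hc.integral t ht).hasDerivAt (hc.isOpen.mem_nhds ht)
  have hconv : Convex ℝ I := hc.ordConnected.convex
  -- The potential exists only locally; local constancy, phrased as a zero derivative, passes to the
  -- whole interval by convexity.
  have hloc : ∀ s ∈ I, HasDerivAt (fun s => perp (nuX u (c s))) 0 s := by
    intro s hs
    obtain ⟨ρ, hρ, -, ψ, hψ⟩ := exists_isSolution hΩ hu hchar hmin (hc.mapsTo hs)
    have hmem : I ∩ c ⁻¹' ball (c s) (3 * ρ) ∈ 𝓝 s :=
      inter_mem (hc.isOpen.mem_nhds hs)
        ((hder s hs).continuousAt (ball_mem_nhds _ (by positivity)))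
    obtain ⟨δ, hδ, hsub⟩ := nhds_basis_ball.mem_iff.1 hmem
    have hseg : ∀ a ∈ ball s δ, ∀ b ∈ ball s δ, a < b →
        perp (nuX u (c b)) = perp (nuX u (c a)) := by
      intro a ha b hb hab
      have hss : Icc a b ⊆ ball s δ := (convex_ball s δ).ordConnected.out ha hb
      exact hψ.eq_along_integralCurve (convex_ball _ _) hab
        (fun t ht => hder t (hsub (hss ht)).1) (fun t ht => (hsub (hss ht)).2)
    refine (hasDerivAt_const s (perp (nuX u (c s)))).congr_of_eventuallyEq ?_
    filter_upwards [ball_mem_nhds s hδ] with b hb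
    rcases lt_trichotomy s b with h | h | h
    · exact hseg s (mem_ball_self hδ) b hb h
    · rw [h]
    · exact (hseg b hb s (mem_ball_self hδ) h).symm
  have hconst : ∀ s ∈ I, perp (nuX u (c s)) = perp (nuX u (c t₀)) := by
    intro s hs
    have := hconv.norm_image_sub_le_of_norm_hasDerivWithin_le (C := 0)
      (fun t ht => (hloc t ht).hasDerivWithinAt) (by simp) ht₀ hs
    rwa [zero_mul, norm_le_zero_iff, sub_eq_zero] at this
  have hd : ∀ s ∈ I, HasDerivAt (fun s => c s - s • perp (nuX u (c t₀))) 0 s := by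
    intro s hs
    have := (hder s hs).fun_sub ((hasDerivAt_id' s).smul_const (perp (nuX u (c t₀))))
    rwa [hconst s hs, one_smul, sub_self] at this
  have := hconv.norm_image_sub_le_of_norm_hasDerivWithin_le (C := 0)
    (fun t ht => (hd t ht).hasDerivWithinAt) (by simp) ht₀ ht
  rw [zero_mul, norm_le_zero_iff, sub_eq_zero, sub_eq_iff_eq_add] at this
  rw [this]
  module

/-- A seed curve passes through every point. -/
theorem exists_isSeedCurve (hΩ : IsOpen Ω) (hu : ContDiffOn ℝ 1 u Ω)
    (hchar : ∀ z ∈ Ω, ¬ IsCharacteristic u z) (hmin : IsHMinimal u Ω) {z : Plane} (hz : z ∈ Ω) :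
    ∃ (I : Set ℝ) (γ : ℝ → Plane), 0 ∈ I ∧ IsSeedCurve u Ω I γ ∧ γ 0 = z := by
  obtain ⟨ρ, hρ, hball, -, C, hC⟩ := exists_ruling hΩ hu hchar hmin hz
  -- With speed bound 1, a ball of radius `ρ/2` allows the existence time `ρ/2`.
  set a : NNReal := ⟨ρ / 2, by positivity⟩ with ha
  have haρ : (a : ℝ) = ρ / 2 := rfl
  have hsub : closedBall z (a : ℝ) ⊆ ball z ρ := closedBall_subset_ball (by rw [haρ]; linarith)
  have hpl : IsPicardLindelof (fun _ => nuX u) (tmin := -(ρ / 2)) (tmax := ρ / 2)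
      ⟨0, by constructor <;> linarith⟩ z a 0 1 C := by
    refine IsPicardLindelof.of_time_independent
      (fun x hx => (norm_nuX (hchar x (hball (hsub hx)))).le) (hC.mono hsub) ?_
    simp [haρ]
  obtain ⟨α, hα0, hα⟩ := hpl.exists_eq_forall_mem_Icc_hasDerivWithinAt
    (mem_closedBall_self le_rfl)
  have hα0' : α 0 = z := hα0
  have hαd : ∀ t ∈ Ioo (-(ρ / 2)) (ρ / 2), HasDerivAt α (nuX u (α t)) t := fun t ht =>
    (hα t (Ioo_subset_Icc_self ht)).hasDerivAt (Icc_mem_nhds ht.1 ht.2)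
  have h0 : (0 : ℝ) ∈ Ioo (-(ρ / 2)) (ρ / 2) := by constructor <;> linarith
  have hmem : Ioo (-(ρ / 2)) (ρ / 2) ∩ α ⁻¹' Ω ∈ 𝓝 (0 : ℝ) :=
    inter_mem (isOpen_Ioo.mem_nhds h0)
      ((hαd 0 h0).continuousAt (hΩ.mem_nhds (by rwa [hα0'])))
  obtain ⟨δ, hδ, hδs⟩ := nhds_basis_ball.mem_iff.1 hmem
  exact ⟨ball 0 δ, α, mem_ball_self hδ, ⟨isOpen_ball, (convex_ball _ _).ordConnected,
    fun t ht => (hδs ht).2, fun t ht => (hαd t (hδs ht).1).hasDerivWithinAt⟩, hα0'⟩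

/-! ### Parameterization along seed curves and their regularity -/

variable {I : Set ℝ} {γ : ℝ → Plane}

theorem IsSeedCurve.hasDerivAt (hγ : IsSeedCurve u Ω I γ) {s : ℝ} (hs : s ∈ I) :
    HasDerivAt γ (nuX u (γ s)) s :=
  (hγ.integral s hs).hasDerivAt (hγ.isOpen.mem_nhds hs)

theorem IsSeedCurve.continuousAt_tangent (hΩ : IsOpen Ω) (hu : ContDiffOn ℝ 1 u Ω)
    (hchar : ∀ z ∈ Ω, ¬ IsCharacteristic u z) (hγ : IsSeedCurve u Ω I γ) {s : ℝ} (hs : s ∈ I) :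
    ContinuousAt (fun s => nuX u (γ s)) s :=
  ContinuousAt.comp (f := γ) (g := nuX u)
    ((continuousOn_nuX hΩ hu hchar).continuousAt (hΩ.mem_nhds (hγ.mapsTo hs)))
    (hγ.hasDerivAt hs).continuousAt

theorem IsSeedCurve.seedMap_eq (hγ : IsSeedCurve u Ω I γ) {x : ℝ × ℝ} (hx : x.1 ∈ I) :
    seedMap γ x = γ x.1 + x.2 • perp (nuX u (γ x.1)) := by
  rw [seedMap, (hγ.hasDerivAt hx).deriv]
  ext i
  fin_cases i
  · simp [perp_apply_zero]
  · simp [perp_apply_one, sub_eq_add_neg]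

/-- Projecting a graph to the plane loses nothing: `F` is an open embedding on `D`, hence its
continuous lift `Φ` is an embedding, with image cut out of the graph by the cylinder over `F '' D`.
-/
theorem isLocalParam_of_graph {S : Set Heis} {w : Plane → ℝ} (hw : ContinuousOn w Ω)
    (hS : S = graphOver w Ω) {D : Set (ℝ × ℝ)} (hD : IsOpen D) {F : ℝ × ℝ → Plane}
    (e : OpenPartialHomeomorph (ℝ × ℝ) Plane) (hDe : D ⊆ e.source) (heF : EqOn F e D)
    (hF : MapsTo F D Ω) {Φ : ℝ × ℝ → Heis} (hΦ : ∀ x ∈ D, Φ x = (F x, w (F x))) :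
    IsLocalParam S Φ D := by
  have hFc : ContinuousOn F D := (e.continuousOn.mono hDe).congr heF
  have hopen : ∀ W ⊆ D, IsOpen W → IsOpen (F '' W) := fun W hWD hW => by
    rw [(heF.mono hWD).image_eq]
    exact e.isOpen_image_of_subset_source hW (hWD.trans hDe)
  have hemb : Topology.IsEmbedding (D.domRestrict F) := by
    refine (Topology.IsOpenEmbedding.of_continuous_injective_isOpenMap hFc.domRestrict
      ?_ fun W hW => ?_).isEmbedding
    · exact ((e.injOn.mono hDe).congr heF.symm).injective
    · rw [domRestrict_eq, image_comp]
      exact hopen _ (Subtype.coe_image_subset _ _) (hD.isOpenMap_subtype_val _ hW)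
  refine ⟨hD, ?_, (F '' D) ×ˢ univ, (hopen D subset_rfl hD).prod isOpen_univ, ?_⟩
  · have hΦc : ContinuousOn Φ D := (hFc.prodMk (hw.comp hFc hF)).congr hΦ
    refine Topology.IsEmbedding.of_comp hΦc.domRestrict continuous_fst ?_
    have : Prod.fst ∘ D.domRestrict Φ = D.domRestrict F := by
      funext x
      simp [domRestrict_apply, hΦ x x.2]
    rwa [this]
  · subst hS
    ext P
    constructor
    · rintro ⟨x, hx, rfl⟩
      rw [hΦ x hx]
      exact ⟨⟨hF hx, rfl⟩, ⟨x, hx, rfl⟩, mem_univ _⟩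
    · rintro ⟨⟨-, h2⟩, ⟨x, hx, hxP⟩, -⟩
      refine ⟨x, hx, ?_⟩
      rw [hΦ x hx, hxP, ← h2]

/-- Near a seed curve, an H-minimal graph is parameterized as a ruled surface. -/
theorem IsSeedCurve.exists_isLocalParam (hΩ : IsOpen Ω) (hu : ContDiffOn ℝ 1 u Ω)
    (hchar : ∀ z ∈ Ω, ¬ IsCharacteristic u z) (hmin : IsHMinimal u Ω)
    (hγ : IsSeedCurve u Ω I γ) {s₀ : ℝ} (hs₀ : s₀ ∈ I) :
    ∃ δ > 0, Ioo (s₀ - δ) (s₀ + δ) ⊆ I ∧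
      IsLocalParam (graphOver u Ω) (ruledMap γ (fun s => u (γ s)))
        (Ioo (s₀ - δ) (s₀ + δ) ×ˢ Ioo (-δ) δ) := by
  have hz₀ := hγ.mapsTo hs₀
  obtain ⟨ρ, hρ, hball, hline, C, hC⟩ := exists_ruling hΩ hu hchar hmin hz₀
  have hn := norm_nuX (hchar _ hz₀)
  have hγs : HasStrictDerivAt γ (nuX u (γ s₀)) s₀ :=
    hasStrictDerivAt_of_hasDerivAt_of_continuousAt (f' := fun s => nuX u (γ s))
      (by filter_upwards [hγ.isOpen.mem_nhds hs₀] with s hs using hγ.hasDerivAt hs)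
      (hγ.continuousAt_tangent hΩ hu hchar hs₀)
  have hmem : I ∩ γ ⁻¹' ball (γ s₀) ρ ∈ 𝓝 s₀ :=
    inter_mem (hγ.isOpen.mem_nhds hs₀)
      ((hγ.hasDerivAt hs₀).continuousAt (ball_mem_nhds _ hρ))
  obtain ⟨η, hη, hηs⟩ := nhds_basis_ball.mem_iff.1 hmem
  have hγ1 : ∀ s ∈ ball s₀ η, ∀ s' ∈ ball s₀ η, ‖γ s - γ s'‖ ≤ 1 * |s - s'| := by
    intro s hs s' hs'
    exact (convex_ball s₀ η).norm_image_sub_le_of_norm_hasDerivWithin_le (C := 1)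
      (fun t ht => (hγ.hasDerivAt (hηs ht).1).hasDerivWithinAt)
      (fun t ht => (norm_nuX (hchar _ (hγ.mapsTo (hηs ht).1))).le) hs' hs
  have hlip : ∀ s ∈ ball s₀ η, ∀ s' ∈ ball s₀ η,
      ‖perp (nuX u (γ s)) - perp (nuX u (γ s'))‖ ≤ C * |s - s'| := by
    intro s hs s' hs'
    rw [perp_sub, norm_perp, ← dist_eq_norm]
    refine (hC.dist_le_mul _ (hηs hs).2 _ (hηs hs').2).trans ?_
    gcongr
    rw [dist_eq_norm]
    simpa using hγ1 s hs s' hs'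
  have hstrict : HasStrictFDerivAt (fun x : ℝ × ℝ => γ x.1 + x.2 • perp (nuX u (γ x.1)))
      (frameEquiv _ hn : (ℝ × ℝ) →L[ℝ] Plane) (s₀, 0) :=
    hasStrictFDerivAt_add_smul hγs
      (perpL.continuous.continuousAt.comp (hγ.continuousAt_tangent hΩ hu hchar hs₀))
      (ball_mem_nhds s₀ hη) hlip
  set e := hstrict.toOpenPartialHomeomorph
    (fun x : ℝ × ℝ => γ x.1 + x.2 • perp (nuX u (γ x.1))) with he
  have hsrc : e.source ∈ 𝓝 (s₀, (0 : ℝ)) :=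
    e.open_source.mem_nhds hstrict.mem_toOpenPartialHomeomorph_source
  obtain ⟨κ, hκ, hκs⟩ := nhds_basis_ball.mem_iff.1 hsrc
  -- `η` keeps the curve in the Lipschitz ball, `ρ` keeps the rulings in `Ω`, and `κ` keeps the
  -- parameters in the domain of the local inverse.
  obtain ⟨δ, hδ, hδη, hδρ, hδκ⟩ : ∃ δ > 0, δ ≤ η ∧ δ ≤ ρ ∧ δ ≤ κ :=
    ⟨min η (min ρ κ), by positivity, min_le_left _ _, (min_le_right _ _).trans (min_le_left _ _),
      (min_le_right _ _).trans (min_le_right _ _)⟩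
  have hIoo : Ioo (s₀ - δ) (s₀ + δ) ⊆ ball s₀ η := by
    rw [← Real.ball_eq_Ioo]; exact ball_subset_ball hδη
  have hDe : Ioo (s₀ - δ) (s₀ + δ) ×ˢ Ioo (-δ) δ ⊆ e.source := by
    refine Subset.trans ?_ hκs
    have : Ioo (-δ) δ = ball (0 : ℝ) δ := by rw [Real.ball_eq_Ioo]; simp
    rw [← Real.ball_eq_Ioo, this, ball_prod_same]
    exact ball_subset_ball hδκ
  have hF : ∀ x ∈ Ioo (s₀ - δ) (s₀ + δ) ×ˢ Ioo (-δ) δ,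
      seedMap γ x = γ x.1 + x.2 • perp (nuX u (γ x.1)) := fun x hx =>
    hγ.seedMap_eq (hηs (hIoo hx.1)).1
  have habs : ∀ x ∈ Ioo (s₀ - δ) (s₀ + δ) ×ˢ Ioo (-δ) δ, |x.2| ≤ ρ := fun x hx =>
    (abs_lt.2 hx.2).le.trans hδρ
  refine ⟨δ, hδ, fun s hs => (hηs (hIoo hs)).1,
    isLocalParam_of_graph hu.continuousOn rfl (isOpen_Ioo.prod isOpen_Ioo) (F := seedMap γ) e hDe
      hF (fun x hx => ?_) fun x hx => ?_⟩
  · rw [hF x hx]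
    exact (hline _ (hηs (hIoo hx.1)).2 _ (habs x hx)).1
  · have h1 := height_along_ruling hΩ hu hchar (hline _ (hηs (hIoo hx.1)).2) (habs x hx)
    rw [← hF x hx] at h1
    rw [ruledMap, h1, (hγ.hasDerivAt (hηs (hIoo hx.1)).1).deriv]

/-- Seed curves are twice continuously differentiable. -/
theorem IsSeedCurve.contDiffOn_two (hΩ : IsOpen Ω) (hu : ContDiffOn ℝ 1 u Ω)
    (hchar : ∀ z ∈ Ω, ¬ IsCharacteristic u z) (hmin : IsHMinimal u Ω)
    (hγ : IsSeedCurve u Ω I γ) : ContDiffOn ℝ 2 γ I := by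
  set m : ℝ → Plane := fun s => nuX u (γ s) with hm
  have hγc : ∀ s ∈ I, ContinuousAt γ s := fun s hs => (hγ.hasDerivAt hs).continuousAt
  have hmc : ∀ s ∈ I, ContinuousAt m s := fun s hs => hγ.continuousAt_tangent hΩ hu hchar hs
  have hpc : ∀ s ∈ I, ContinuousAt (fun s => perp (m s)) s := fun s hs =>
    perpL.continuous.continuousAt.comp (hmc s hs)
  have hdu : ∀ y ∈ Ω, ContinuousAt (fderiv ℝ u) y := fun y hy =>
    (hu.continuousOn_fderiv_of_isOpen hΩ le_rfl).continuousAt (hΩ.mem_nhds hy)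
  have hfd : ∀ y ∈ Ω, HasFDerivAt u (fderiv ℝ u y) y := fun y hy =>
    (differentiableAt_of_contDiffOn hΩ hu hy).hasFDerivAt
  have main : ∀ s₀ ∈ I, ∃ A : ℝ → Plane, ContinuousAt A s₀ ∧
      ∀ᶠ s in 𝓝 s₀, HasDerivAt m (A s) s := by
    intro s₀ hs₀
    have hz₀ := hγ.mapsTo hs₀
    obtain ⟨ρ, hρ, hball, hline, C, hC⟩ := exists_ruling hΩ hu hchar hmin hz₀
    -- a distance at which the ruling is nondegenerate
    obtain ⟨r, hr0, hrρ, hnd⟩ : ∃ r : ℝ, 0 < r ∧ r ≤ ρ ∧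
        0 < gaussNorm u (γ s₀ + r • perp (m s₀)) - r / 2 := by
      have hG : ContinuousAt (fun r : ℝ => gaussNorm u (γ s₀ + r • perp (m s₀)) - r / 2) 0 := by
        refine ContinuousAt.sub ?_ (by fun_prop)
        have hc : ContinuousAt (fun r : ℝ => γ s₀ + r • perp (m s₀)) 0 := by fun_prop
        refine ContinuousAt.comp (f := fun r : ℝ => γ s₀ + r • perp (m s₀)) (g := gaussNorm u) ?_ hc
        rw [zero_smul, add_zero]
        exact (continuousOn_gaussNorm hΩ hu).continuousAt (hΩ.mem_nhds hz₀)
      have h0 : ∀ᶠ r : ℝ in 𝓝[>] 0, 0 < gaussNorm u (γ s₀ + r • perp (m s₀)) - r / 2 := by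
        refine nhdsWithin_le_nhds (hG.eventually (lt_mem_nhds ?_))
        simpa using gaussNorm_pos (hchar _ hz₀)
      obtain ⟨r, h1, h2⟩ := (h0.and (Ioc_mem_nhdsGT hρ)).exists
      exact ⟨r, h2.1, h2.2, h1⟩
    have hrabs : |r| ≤ ρ := by rwa [abs_of_pos hr0]
    set F : ℝ → Plane := fun s => γ s + r • perp (m s) with hF
    have hnear : ∀ᶠ s in 𝓝 s₀, s ∈ I ∧ γ s ∈ ball (γ s₀) ρ :=
      inter_mem (hγ.isOpen.mem_nhds hs₀) (hγc s₀ hs₀ (ball_mem_nhds _ hρ))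
    have hFc : ∀ s ∈ I, ContinuousAt F s := fun s hs => (hγc s hs).add ((hpc s hs).const_smul r)
    have hcoef : ∀ s ∈ I, γ s ∈ ball (γ s₀) ρ →
        inner ℝ (γ s) (perp (m s)) / 2 - fderiv ℝ u (F s) (m s)
          = gaussNorm u (F s) - r / 2 := by
      intro s hs hsρ
      obtain ⟨h1, h2⟩ := hline (γ s) hsρ r hrabs
      have h3 := fderiv_nuX (differentiableAt_of_contDiffOn hΩ hu h1) (hchar _ h1)
      rw [h2, inner_add_left, real_inner_smul_left, real_inner_self_eq_norm_sq, norm_perp,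
        norm_nuX (hchar _ (hγ.mapsTo hs))] at h3
      simp only [hF, hm]
      rw [h3]
      ring
    have hF₀ : F s₀ ∈ Ω := (hline (γ s₀) (mem_ball_self hρ) r hrabs).1
    have hndev : ∀ᶠ s in 𝓝 s₀, 0 < gaussNorm u (F s) - r / 2 := by
      have hc : ContinuousAt (fun s => gaussNorm u (F s) - r / 2) s₀ :=
        (ContinuousAt.comp (f := F)
          ((continuousOn_gaussNorm hΩ hu).continuousAt (hΩ.mem_nhds hF₀)) (hFc s₀ hs₀)).sub_const _
      exact hc.eventually (lt_mem_nhds hnd)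
    -- The same `r` serves all `s` near `s₀`, so one formula gives the derivative of `m` throughout
    -- a neighbourhood and its continuity can be read off.
    refine ⟨fun s => ((fderiv ℝ u (γ s) (m s) - r / 2 - fderiv ℝ u (F s) (m s)) /
      (r * (inner ℝ (γ s) (perp (m s)) / 2 - fderiv ℝ u (F s) (m s)))) • perp (m s), ?_, ?_⟩
    · have c1 : ContinuousAt (fun s => fderiv ℝ u (γ s) (m s)) s₀ :=
        (ContinuousAt.comp (f := γ) (hdu _ hz₀) (hγc s₀ hs₀)).clm_apply (hmc s₀ hs₀)
      have c2 : ContinuousAt (fun s => fderiv ℝ u (F s) (m s)) s₀ :=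
        (ContinuousAt.comp (f := F) (hdu _ hF₀) (hFc s₀ hs₀)).clm_apply (hmc s₀ hs₀)
      have c3 : ContinuousAt (fun s => inner ℝ (γ s) (perp (m s))) s₀ :=
        (hγc s₀ hs₀).inner (hpc s₀ hs₀)
      refine (((c1.sub_const _).sub c2).div (continuousAt_const.mul ((c3.div_const 2).sub c2))
        (mul_ne_zero hr0.ne' ?_)).smul (hpc s₀ hs₀)
      exact (hcoef s₀ hs₀ (mem_ball_self hρ)).trans_ne hnd.ne'
    · filter_upwards [hnear.eventually_nhds, hndev] with s hs hsnd
      obtain ⟨hsI, hsρ⟩ := hs.self_of_nhds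
      have hmO : (fun s' => m s' - m s) =O[𝓝 s] fun s' => s' - s := by
        refine IsBigO.trans (.of_bound C ?_) (hγ.hasDerivAt hsI).isBigO_sub
        filter_upwards [hs] with s' hs'
        rw [← dist_eq_norm, ← dist_eq_norm]
        exact hC.dist_le_mul _ hs'.2 _ hsρ
      refine hasDerivAt_tangent (hγ.hasDerivAt hsI) ?_ hmO ?_ (hfd _ (hγ.mapsTo hsI))
        (hfd _ (hline (γ s) hsρ r hrabs).1) hr0.ne' ?_
      · filter_upwards [hs] with s' hs' using norm_nuX (hchar _ (hγ.mapsTo hs'.1))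
      · filter_upwards [hs] with s' hs'
        exact height_along_ruling hΩ hu hchar (hline _ hs'.2) hrabs
      · exact (hcoef s hsI hsρ).trans_ne hsnd.ne'
  have hm1 : ContDiffOn ℝ 1 m I := by
    have h := (contDiffOn_succ_iff_deriv_of_isOpen (𝕜 := ℝ) (n := 0) (f := m) hγ.isOpen).2
      ⟨fun s hs => ?_, by simp, contDiffOn_zero.2 fun s hs => ?_⟩
    · rwa [zero_add] at h
    · obtain ⟨A, -, hA⟩ := main s hs
      exact hA.self_of_nhds.differentiableAt.differentiableWithinAt
    · obtain ⟨A, hAc, hA⟩ := main s hs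
      exact (hAc.congr (hA.mono fun _ h => h.deriv.symm)).continuousWithinAt
  have h := (contDiffOn_succ_iff_deriv_of_isOpen (𝕜 := ℝ) (n := 1) (f := γ) hγ.isOpen).2
    ⟨fun s hs => (hγ.hasDerivAt hs).differentiableAt.differentiableWithinAt, by simp,
      hm1.congr fun s hs => (hγ.hasDerivAt hs).deriv⟩
  rwa [one_add_one_eq_two] at h

end GaussMap

end HeisenbergGraph

theorem theorem1 (Ω : Set Plane) (hΩ : IsOpen Ω) (hΩc : IsConnected Ω)
    (u : Plane → ℝ) (hu : ContDiffOn ℝ 1 u Ω)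
    (hchar : ∀ z ∈ Ω, ¬ IsCharacteristic u z)
    (hmin : IsHMinimal u Ω)
    (hW : ∀ i : Fin 2, MemW11 Ω (fun z => nuX u z i)) :
    -- the integral curves of `ν_X^⊥` are straight lines
    (∀ (I : Set ℝ) (c : ℝ → Plane), IsCurveIn Ω (fun z => perp (nuX u z)) I c →
      ∀ t₀ ∈ I, ∀ t ∈ I, c t = c t₀ + (t - t₀) • perp (nuX u (c t₀))) ∧
    -- there is a seed curve through every point
    (∀ z ∈ Ω, ∃ (I : Set ℝ) (γ : ℝ → Plane), 0 ∈ I ∧ IsSeedCurve u Ω I γ ∧ γ 0 = z) ∧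
    (∀ (I : Set ℝ) (γ : ℝ → Plane), IsSeedCurve u Ω I γ →
      -- near every point of a seed curve, the surface is parameterized as a ruled surface
      (∀ s₀ ∈ I, ∃ δ > 0, Ioo (s₀ - δ) (s₀ + δ) ⊆ I ∧
        IsLocalParam (graphOver u Ω) (ruledMap γ (fun s => u (γ s)))
          (Ioo (s₀ - δ) (s₀ + δ) ×ˢ Ioo (-δ) δ)) ∧
      -- regularity of the seed curve and of the height function
      (∀ ε : ℝ, 0 < ε → ENNReal.ofReal ε < thickness Ω I γ →
        ContDiffOn ℝ 2 γ I ∧ ContDiffOn ℝ 1 (fun s => u (γ s)) I)) := by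
  refine ⟨fun I c hc t₀ ht₀ t ht => eq_line_of_isCurveIn_perp hΩ hu hchar hmin hc ht₀ ht,
    fun z hz => exists_isSeedCurve hΩ hu hchar hmin hz, fun I γ hγ =>
    ⟨fun s₀ hs₀ => hγ.exists_isLocalParam hΩ hu hchar hmin hs₀, fun _ _ _ => ?_⟩⟩
  have h2 := hγ.contDiffOn_two hΩ hu hchar hmin
  exact ⟨h2, hu.comp (h2.of_le one_le_two) hγ.mapsTo⟩
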